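/- Let $\mathfrak{o}$ be a complete discrete valuation ring of characteristic $0$ with finite residue field $\mathbb{F}_q$ of characteristic $2$, maximal ideal $\wp$ and uniformizer $\pi$. Define $e$ by $2\mathfrak{o}=\wp^{e}$, let $\ell>e$, and write $\mathfrak{o}_k=\mathfrak{o}/\wp^k$. For $i\le 2\ell$ let $K^{i}=\ker(\mathrm{SL}_2(\mathfrak{o}_{2\ell})\to\mathrm{SL}_2(\mathfrak{o}_{i}))$. Fix an additive character $\psi:\mathfrak{o}_{2\ell}\to\mathbb{C}^\times$ with $\psi(\pi^{2\ell-1})\neq 1$. For $A\in M_2(\mathfrak{o}_\ell)$ let $\psi_{[A]}$ be the one-dimensional character of $K^{\ell}$ given by $\psi_{[A]}(I+\pi^{\ell}B)=\psi(\pi^{\ell}\,\mathrm{tr}(\hat{A}B))$, where $\hat{A}\in M_2(\mathfrak{o}_{2\ell})$ is any lift of $A$, and let $\mathrm{Irr}(\mathrm{SL}_2(\mathfrak{o}_{2\ell})\mid\psi_{[A]})$ be the set of irreducible complex constituents of $\mathrm{Ind}_{K^{\ell}}^{\mathrm{SL}_2(\mathfrak{o}_{2\ell})}\psi_{[A]}$.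 Call $A$ cyclic if $\{v,Av\}$ generates $\mathfrak{o}_\ell^{2}$ for some $v\in\mathfrak{o}_\ell^{2}$, and let $\bar{A}\in M_2(\mathbb{F}_q)$ be its reduction modulo $\wp$; $\bar{A}$ is split semisimple if it is semisimple with all eigenvalues in $\mathbb{F}_q$. An irreducible complex representation of $\mathrm{SL}_2(\mathfrak{o}_{2\ell})$ is primitive if neither it nor any of its twists by one-dimensional characters is trivial on $K^{2\ell-1}$. Then the following hold. 0. Every primitive irreducible representation of $\mathrm{SL}_2(\mathfrak{o}_{2\ell})$ has dimension at most $(q+1)q^{2\ell-1}$. 1. For every cyclic $A\in M_2(\mathfrak{o}_\ell)$ and every $\rho\in\mathrm{Irr}(\mathrm{SL}_2(\mathfrak{o}_{2\ell})\mid\psi_{[A]})$, one has $\dim\rho=(q+1)q^{2\ell-1}$ if and only if $\bar{A}$ is split semisimple. 2. The group $\mathrm{SL}_2(\mathfrak{o}_{2\ell})$ has exactly $\frac{(q-1)^2q^{2\ell-2}}{2}$ inequivalent primitive irreducible representations of dimension $(q+1)q^{2\ell-1}$. -/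

import Mathlib

open scoped Matrix

noncomputable section

namespace SLTwo

open IsLocalRing

section Rings

variable (O : Type*) [CommRing O] [IsLocalRing O]

/-- The finite quotient `𝔬_k = 𝔬 / ℘ ^ k`. -/
abbrev Quo (k : ℕ) : Type _ := O ⧸ maximalIdeal O ^ k

/-- The natural surjection `𝔬_r → 𝔬_i` for `i ≤ r`. -/
abbrev red {i r : ℕ} (h : i ≤ r) : Quo O r →+* Quo O i :=
  Ideal.Quotient.factorPow (maximalIdeal O) h

/-- The natural surjection `𝔬_k → 𝔬 / ℘` onto the residue field, for `k ≥ 1`. -/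
def toResidue {k : ℕ} (h : 1 ≤ k) : Quo O k →+* ResidueField O :=
  Ideal.Quotient.factor (Ideal.pow_le_self (Nat.one_le_iff_ne_zero.mp h))

/-- The number `q` of elements of the residue field. -/
def residueCard : ℕ := Nat.card (ResidueField O)

/-- The group `SL₂(𝔬_r)`. -/
abbrev SL (r : ℕ) : Type _ := Matrix.SpecialLinearGroup (Fin 2) (Quo O r)

/-- The congruence subgroup `K^i`, the kernel of `SL₂(𝔬_r) → SL₂(𝔬_i)`. -/
def congruenceSubgroup {i r : ℕ} (h : i ≤ r) : Subgroup (SL O r) :=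
  (Matrix.SpecialLinearGroup.map (n := Fin 2) (red O h)).ker

end Rings

section Matrices

/-- `A` is cyclic: some `v` is such that `v, A v, …, A ^ (n - 1) v` generate `R ^ n`. -/
def IsCyclicMatrix {R : Type*} [CommRing R] {n : ℕ} (A : Matrix (Fin n) (Fin n) R) : Prop :=
  ∃ v : Fin n → R,
    Submodule.span R (Set.range fun j : Fin n => (A ^ (j : ℕ)) *ᵥ v) = ⊤

/-- A matrix over a field is split semisimple: it is semisimple and all its eigenvalues lie in
the field. -/
def IsSplitSemisimple {k : Type*} [Field k] {n : ℕ} (A : Matrix (Fin n) (Fin n) k) : Prop :=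
  A.charpoly.Splits ∧ Module.End.IsSemisimple (Matrix.toLin' A)

end Matrices

section Characters

variable {O : Type*} [CommRing O] [IsLocalRing O] {l : ℕ}

/-- An entrywise lift `Â ∈ M₂(𝔬_{2ℓ})` of `A ∈ M₂(𝔬_ℓ)`. -/
def lift (A : Matrix (Fin 2) (Fin 2) (Quo O l)) : Matrix (Fin 2) (Fin 2) (Quo O (2 * l)) :=
  A.map (Function.surjInv
    (Ideal.Quotient.factor_surjective
      (Ideal.pow_le_pow_right (I := maximalIdeal O) (by omega : l ≤ 2 * l))))

theorem lift_map (A : Matrix (Fin 2) (Fin 2) (Quo O l)) :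
    (lift A).map (red O (by omega : l ≤ 2 * l)) = A := by
  ext i j
  exact Function.surjInv_eq (Ideal.Quotient.factor_surjective
      (Ideal.pow_le_pow_right (I := maximalIdeal O) (by omega : l ≤ 2 * l))) (A i j)

theorem mul_eq_zero_of_red {x y : Quo O (2 * l)}
    (hx : red O (by omega : l ≤ 2 * l) x = 0) (hy : red O (by omega : l ≤ 2 * l) y = 0) :
    x * y = 0 := by
  obtain ⟨a, rfl⟩ := Ideal.Quotient.mk_surjective x
  obtain ⟨b, rfl⟩ := Ideal.Quotient.mk_surjective y
  have ha : a ∈ maximalIdeal O ^ l := Ideal.Quotient.eq_zero_iff_mem.mp hx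
  have hb : b ∈ maximalIdeal O ^ l := Ideal.Quotient.eq_zero_iff_mem.mp hy
  rw [← map_mul, Ideal.Quotient.eq_zero_iff_mem, two_mul, pow_add]
  exact Ideal.mul_mem_mul ha hb

theorem red_sub_one (k : congruenceSubgroup O (by omega : l ≤ 2 * l)) (i j : Fin 2) :
    red O (by omega : l ≤ 2 * l)
      ((((k : SL O (2 * l)) : Matrix (Fin 2) (Fin 2) (Quo O (2 * l))) - 1) i j) = 0 := by
  have h := congrArg (fun g : SL O l => (g : Matrix (Fin 2) (Fin 2) (Quo O l)) i j)
    (MonoidHom.mem_ker.mp k.2)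
  rw [Matrix.sub_apply, map_sub]
  have h' : red O (by omega : l ≤ 2 * l) ((k : SL O (2 * l)).1 i j) =
      (1 : Matrix (Fin 2) (Fin 2) (Quo O l)) i j := h
  rw [sub_eq_zero]
  refine h'.trans ?_
  rw [Matrix.one_apply, Matrix.one_apply]
  split_ifs <;> simp

/-- The restriction `ψ_[A]` of `ψ_A` to `K^ℓ ⊆ SL₂(𝔬_{2ℓ})`. As `π^ℓ B = k - I` for
`k = I + π^ℓ B`, the value `ψ (π^ℓ tr (Â B))` at `k` is written without `π` and `B` as
`ψ (tr (Â (k - I)))`; see `psiClass_apply` and `psiClass_eq`. -/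
def psiClass (ψ : AddChar (Quo O (2 * l)) ℂ) (A : Matrix (Fin 2) (Fin 2) (Quo O l)) :
    congruenceSubgroup O (by omega : l ≤ 2 * l) →* ℂ where
  toFun k := ψ (Matrix.trace (lift A *
    (((k : SL O (2 * l)) : Matrix (Fin 2) (Fin 2) (Quo O (2 * l))) - 1)))
  map_one' := by simp
  map_mul' k k' := by
    have h0 : ((((k : SL O (2 * l)) : Matrix (Fin 2) (Fin 2) (Quo O (2 * l))) - 1) *
        (((k' : SL O (2 * l)) : Matrix (Fin 2) (Fin 2) (Quo O (2 * l))) - 1)) = 0 := by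
      ext i j
      rw [Matrix.mul_apply]
      exact Finset.sum_eq_zero fun t _ => mul_eq_zero_of_red (red_sub_one k i t)
        (red_sub_one k' t j)
    rw [← AddChar.map_add_eq_mul, ← Matrix.trace_add, ← mul_add]
    congr 3
    rw [← sub_eq_zero, ← h0]
    have h1 : (((k * k' : congruenceSubgroup O (by omega : l ≤ 2 * l)) : SL O (2 * l)) :
        Matrix (Fin 2) (Fin 2) (Quo O (2 * l))) =
        ((k : SL O (2 * l)) : Matrix (Fin 2) (Fin 2) (Quo O (2 * l))) *
          ((k' : SL O (2 * l)) : Matrix (Fin 2) (Fin 2) (Quo O (2 * l))) := rfl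
    rw [h1]
    noncomm_ring

/-- The value of `ψ_[A]` does not depend on the lift of `A`. -/
theorem psiClass_apply (ψ : AddChar (Quo O (2 * l)) ℂ)
    (A : Matrix (Fin 2) (Fin 2) (Quo O l)) (A' : Matrix (Fin 2) (Fin 2) (Quo O (2 * l)))
    (hA : A'.map (red O (by omega : l ≤ 2 * l)) = A)
    (k : congruenceSubgroup O (by omega : l ≤ 2 * l)) :
    psiClass ψ A k = ψ (Matrix.trace (A' *
      (((k : SL O (2 * l)) : Matrix (Fin 2) (Fin 2) (Quo O (2 * l))) - 1))) := by
  have h0 : (lift A - A') *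
      (((k : SL O (2 * l)) : Matrix (Fin 2) (Fin 2) (Quo O (2 * l))) - 1) = 0 := by
    ext i j
    rw [Matrix.mul_apply]
    refine Finset.sum_eq_zero fun t _ => mul_eq_zero_of_red ?_ (red_sub_one k t j)
    have h1 := congrFun (congrFun ((lift_map A).trans hA.symm) i) t
    rw [Matrix.sub_apply, map_sub, sub_eq_zero]
    exact h1
  rw [sub_mul, sub_eq_zero] at h0
  rw [← h0]
  rfl

/-- The defining formula `ψ_A (I + π^ℓ B) = ψ (π^ℓ tr (Â B))`, for any lift `Â` of `A`. -/
theorem psiClass_eq (ψ : AddChar (Quo O (2 * l)) ℂ) (π : O)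
    (A : Matrix (Fin 2) (Fin 2) (Quo O l)) (A' B : Matrix (Fin 2) (Fin 2) (Quo O (2 * l)))
    (hA : A'.map (red O (by omega : l ≤ 2 * l)) = A)
    (k : congruenceSubgroup O (by omega : l ≤ 2 * l))
    (hk : ((k : SL O (2 * l)) : Matrix (Fin 2) (Fin 2) (Quo O (2 * l))) =
      1 + (Ideal.Quotient.mk (maximalIdeal O ^ (2 * l)) π) ^ l • B) :
    psiClass ψ A k =
      ψ ((Ideal.Quotient.mk (maximalIdeal O ^ (2 * l)) π) ^ l * Matrix.trace (A' * B)) := by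
  rw [psiClass_apply ψ A A' hA, hk, add_sub_cancel_left, Matrix.mul_smul, Matrix.trace_smul,
    smul_eq_mul]

end Characters

section Representations

/-- A one dimensional character `χ` of `H` as a representation of `H` on `ℂ`. -/
def charRep {H : Type*} [Group H] (χ : H →* ℂ) : Representation ℂ H ℂ :=
  (algebraMap ℂ (Module.End ℂ ℂ)).toMonoidHom.comp χ

/-- The twist `ρ ⊗ χ` of a representation by a one dimensional character. -/
def twist {G V : Type*} [Group G] [AddCommGroup V] [Module ℂ V]
    (ρ : Representation ℂ G V) (χ : G →* ℂ) : Representation ℂ G V where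
  toFun g := χ g • ρ g
  map_one' := by simp
  map_mul' g h := by rw [map_mul, map_mul, smul_mul_smul_comm]

/-- `ρ ∈ Irr(G | χ)`: `ρ` is irreducible and is isomorphic to a subrepresentation of
`Ind_H^G χ`, where `χ` is a one dimensional character of the subgroup `H` of `G`. -/
def IsIrrAbove {G V : Type*} [Group G] [AddCommGroup V] [Module ℂ V]
    (ρ : Representation ℂ G V) {H : Subgroup G} (χ : H →* ℂ) : Prop :=
  ρ.IsIrreducible ∧
    ∃ f : ρ.IntertwiningMap (Representation.ind H.subtype (charRep χ)), Function.Injective f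

/-- A representation of `SL₂(𝔬_r)` is primitive if neither it nor any of its twists is trivial
on the congruence subgroup `K^(r-1)`. -/
def IsPrimitive {O : Type*} [CommRing O] [IsLocalRing O] {r : ℕ} {V : Type*} [AddCommGroup V]
    [Module ℂ V] (ρ : Representation ℂ (SL O r) V) : Prop :=
  (¬ ∀ k ∈ congruenceSubgroup O (Nat.sub_le r 1), ρ k = 1) ∧
    ∀ χ : SL O r →* ℂ, ¬ ∀ k ∈ congruenceSubgroup O (Nat.sub_le r 1), twist ρ χ k = 1

/-- Isomorphism of the primitive irreducible representations of `SL₂(𝔬_r)` on `ℂ ^ d`. -/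
def primitiveSetoid (O : Type*) [CommRing O] [IsLocalRing O] (r d : ℕ) :
    Setoid {ρ : Representation ℂ (SL O r) (Fin d → ℂ) // ρ.IsIrreducible ∧ IsPrimitive ρ} where
  r ρ σ := Nonempty (ρ.1.Equiv σ.1)
  iseqv :=
    { refl := fun ρ => ⟨Representation.Equiv.refl ρ.1⟩
      symm := fun ⟨e⟩ => ⟨e.symm⟩
      trans := fun ⟨e⟩ ⟨f⟩ => ⟨e.trans f⟩ }

/-- The number of inequivalent primitive irreducible representations of `SL₂(𝔬_r)` of
dimension `d`. -/
def numPrimitive (O : Type*) [CommRing O] [IsLocalRing O] (r d : ℕ) : ℕ :=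
  Nat.card (Quotient (primitiveSetoid O r d))

end Representations

end SLTwo

end

open scoped Matrix

noncomputable section

namespace SLTwo

open IsLocalRing

/-! ### Common eigenvectors, cyclic subrepresentations and Frobenius reciprocity -/

section General

open Module

/-! The argument is Clifford theory for the abelian normal subgroup `K^ℓ`. Write `R = 𝔬_{2ℓ}`, `p =
π^ℓ`, `s = π^(2ℓ-1)`. As `p² = 0`, the matrices `1 + pB` commute, and determinant one means `p tr B
= 0`; so an irreducible `ρ` contains an eigenvector with character `ψ_A`, where `A` matters only
modulo `p` and scalars. If `ρ` is primitive, `A` is not scalar over the residue field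
(`Level.nonScalar`); a cyclic `A` has this property by itself.

Suppose `A` has two distinct eigenvalues in the residue field. By Hensel, `A` is `SL₂`-conjugate to
a diagonal matrix. The diagonal torus preserves the `ψ_A`-eigenspace and is commutative, so it has
an eigenvector `w` there. On `w` the group `D` of matrices diagonal modulo `p` acts by `g ↦ τ(g₀₀)`,
with `τ` a character of `Rˣ` nontrivial on `1 + sR` (`Level.exists_hasTheta`). The line of `w` gives
`dim ρ ≤ [SL₂ : D]`. Translates of `w` by different cosets of `D` have different `K^ℓ`-characters:
the only possible coincidence comes from the Weyl element and would need `p ∣ 2`, which `e < ℓ`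
forbids. Hence equality (`Level.finrank_eq_of_hasTheta`), and the index is `(q+1)q^(2ℓ-1)`.

Otherwise one passes to `GL₂`, because determinant-one elements of a centralizer are awkward to
count in residue characteristic two. In the coinduced representation, matrices that commute with `A`
modulo `p` have the form `a + bA + pX`; they commute with each other on the `ψ_A`-eigenspace
(`IsEig.commute`) and so have a common eigenvector. This bounds `dim ρ` by the index of the
centralizer of `A` in `GL₂(𝔬_ℓ)` (`Level.finrank_le`). The form `det(x + yA)` has few zeros, so the
index is at most `(q²-1)q^(2ℓ-2)`, strictly below the split value.

For the count, representations of maximal dimension correspond to primitive `τ` up to inversion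
(`Level.eq_or_eq_inv`), and `τ ≠ τ⁻¹` again because `p ∤ 2`. There are `(q-1)²q^(2ℓ-2)` primitive
`τ` (`Level.card_isPrim`), and half of them remain. -/

theorem exists_common_eigenvector {V : Type*} [AddCommGroup V] [Module ℂ V]
    [FiniteDimensional ℂ V] [Nontrivial V] {ι : Type*} (T : ι → End ℂ V)
    (hT : ∀ i j v, T i (T j v) = T j (T i v)) :
    ∃ v : V, v ≠ 0 ∧ ∀ i, ∃ c : ℂ, T i v = c • v := by
  induction hn : finrank ℂ V using Nat.strong_induction_on generalizing V with
  | _ n ih =>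
  -- Either all operators are scalars, or one of them has a proper eigenspace; the others preserve
  -- it and the dimension drops.
  by_cases hs : ∀ i, ∃ c : ℂ, ∀ v, T i v = c • v
  · obtain ⟨v, hv⟩ := exists_ne (0 : V)
    exact ⟨v, hv, fun i => (hs i).imp fun c hc => hc v⟩
  · push Not at hs
    obtain ⟨i, hi⟩ := hs
    obtain ⟨c, hc⟩ := End.exists_eigenvalue (T i)
    set E := (T i).eigenspace c with hE
    have hmem : ∀ v, v ∈ E ↔ T i v = c • v := fun v => End.mem_eigenspace_iff
    have hstab : ∀ j, ∀ v ∈ E, T j v ∈ E := by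
      intro j v hv
      rw [hmem] at hv ⊢
      rw [hT, hv, map_smul]
    have hlt : finrank ℂ E < n := by
      rw [← hn]
      refine Submodule.finrank_lt fun h => ?_
      obtain ⟨v, hv⟩ := hi c
      exact hv ((hmem v).1 (h ▸ Submodule.mem_top))
    have : Nontrivial E := (Submodule.nontrivial_iff_ne_bot).2 hc
    obtain ⟨v, hv, h⟩ := ih _ hlt (V := E) (fun j => (T j).restrict (hstab j))
      (fun j j' v => Subtype.ext (hT j j' v)) rfl
    refine ⟨v, fun h0 => hv (Subtype.ext h0), fun j => ?_⟩
    obtain ⟨d, hd⟩ := h j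
    exact ⟨d, congrArg Subtype.val hd⟩

/-- Commutation is asked only on `E`: stabilizer elements of a character commute on its eigenspace,
not on all of `V`. -/
theorem exists_common_eigenvector_mem {V : Type*} [AddCommGroup V] [Module ℂ V]
    [FiniteDimensional ℂ V] {ι : Type*} (T : ι → End ℂ V) (E : Submodule ℂ V)
    (hE : E ≠ ⊥) (hstab : ∀ i, ∀ v ∈ E, T i v ∈ E)
    (hT : ∀ i j, ∀ v ∈ E, T i (T j v) = T j (T i v)) :
    ∃ v ∈ E, v ≠ 0 ∧ ∀ i, ∃ c : ℂ, T i v = c • v := by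
  have : Nontrivial E := Submodule.nontrivial_iff_ne_bot.2 hE
  obtain ⟨v, hv, h⟩ := exists_common_eigenvector (V := E) (fun j => (T j).restrict (hstab j))
      (fun j j' v => Subtype.ext (hT j j' v v.2))
  refine ⟨v, v.2, fun h0 => hv (Subtype.ext h0), fun j => ?_⟩
  obtain ⟨d, hd⟩ := h j
  exact ⟨d, congrArg Subtype.val hd⟩

variable {G : Type*} [Group G] {V : Type*} [AddCommGroup V] [Module ℂ V]

/-- The subrepresentation generated by a vector. -/
def cyclicSub (ρ : Representation ℂ G V) (v : V) : Subrepresentation ρ where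
  toSubmodule := Submodule.span ℂ (Set.range fun g => ρ g v)
  apply_mem_toSubmodule g := by
    intro x hx
    induction hx using Submodule.span_induction with
    | mem x hx =>
      obtain ⟨h, rfl⟩ := hx
      exact Submodule.subset_span ⟨g * h, by simp⟩
    | zero => simp
    | add x y _ _ hx hy => rw [map_add]; exact add_mem hx hy
    | smul c x _ hx => rw [map_smul]; exact Submodule.smul_mem _ _ hx

theorem self_mem_cyclicSub (ρ : Representation ℂ G V) (v : V) :
    v ∈ (cyclicSub ρ v).toSubmodule :=
  Submodule.subset_span ⟨1, by simp⟩

/-- Up to a scalar, `ρ g v` depends only on the coset `gS`, so coset representatives already span.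
-/
theorem finrank_cyclicSub_le [Finite G] (ρ : Representation ℂ G V) (v : V) (S : Subgroup G)
    (hS : ∀ s ∈ S, ∃ c : ℂ, ρ s v = c • v) :
    finrank ℂ (cyclicSub ρ v).toSubmodule ≤ S.index := by
  have : Fintype (G ⧸ S) := Fintype.ofFinite _
  have h : (cyclicSub ρ v).toSubmodule =
      Submodule.span ℂ (Set.range fun x : G ⧸ S => ρ x.out v) := by
    refine le_antisymm (Submodule.span_le.2 ?_) (Submodule.span_mono ?_)
    · rintro _ ⟨g, rfl⟩
      obtain ⟨s, hs⟩ := QuotientGroup.mk_out_eq_mul S g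
      obtain ⟨c, hc⟩ := hS _ (S.inv_mem s.2)
      have hg : g = (QuotientGroup.mk g : G ⧸ S).out * (s : G)⁻¹ := by rw [hs]; group
      have : ρ g v = c • ρ (QuotientGroup.mk g : G ⧸ S).out v := by
        conv_lhs => rw [hg, map_mul, Module.End.mul_apply, hc, map_smul]
      simp only [SetLike.mem_coe]
      rw [this]
      exact Submodule.smul_mem _ _ (Submodule.subset_span ⟨_, rfl⟩)
    · rintro _ ⟨x, rfl⟩
      exact ⟨x.out, rfl⟩
  rw [h, Subgroup.index, Nat.card_eq_fintype_card]
  exact finrank_range_le_card _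

theorem cyclicSub_eq_top (ρ : Representation ℂ G V) (hρ : ρ.IsIrreducible) {v : V} (hv : v ≠ 0) :
    (cyclicSub ρ v).toSubmodule = ⊤ := by
  rcases eq_bot_or_eq_top (cyclicSub ρ v) with h | h
  · exfalso
    have := self_mem_cyclicSub ρ v
    rw [h] at this
    exact hv ((Submodule.mem_bot ℂ).1 this)
  · rw [h]; rfl

theorem finrank_le_index [Finite G] (ρ : Representation ℂ G V) (hρ : ρ.IsIrreducible)
    {v : V} (hv : v ≠ 0) (S : Subgroup G) (hS : ∀ s ∈ S, ∃ c : ℂ, ρ s v = c • v) :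
    finrank ℂ V ≤ S.index := by
  have := finrank_cyclicSub_le ρ v S hS
  rwa [cyclicSub_eq_top ρ hρ hv, finrank_top] at this

/-- A nonzero subspace of an irreducible representation stable under the group is everything. -/
theorem eq_top_of_stable (ρ : Representation ℂ G V) (hρ : ρ.IsIrreducible) (E : Submodule ℂ V)
    (hE : ∀ g, ∀ v ∈ E, ρ g v ∈ E) {v : V} (hv : v ∈ E) (h0 : v ≠ 0) : E = ⊤ := by
  rw [eq_top_iff, ← cyclicSub_eq_top ρ hρ h0]
  refine Submodule.span_le.2 ?_
  rintro _ ⟨g, rfl⟩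
  exact hE g v hv

theorem nontrivial_of_isIrreducible (ρ : Representation ℂ G V) (hρ : ρ.IsIrreducible) :
    Nontrivial V := by
  by_contra hV
  rw [not_nontrivial_iff_subsingleton] at hV
  obtain ⟨a, b, hab⟩ := hρ.exists_pair_ne
  exact hab (Subrepresentation.toSubmodule_injective (Subsingleton.elim _ _))

theorem isIrreducible_of_cyclic (ρ : Representation ℂ G V) [Nontrivial V]
    (h : ∀ v, v ≠ 0 → (cyclicSub ρ v).toSubmodule = ⊤) : ρ.IsIrreducible where
  exists_pair_ne := ⟨⊥, ⊤, fun h => bot_ne_top (congrArg Subrepresentation.toSubmodule h :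
    (⊥ : Submodule ℂ V) = ⊤)⟩
  eq_bot_or_eq_top N := by
    by_cases hN : N.toSubmodule = ⊥
    · exact Or.inl (Subrepresentation.toSubmodule_injective hN)
    · obtain ⟨v, hv, h0⟩ := Submodule.exists_mem_ne_zero_of_ne_bot hN
      refine Or.inr (Subrepresentation.toSubmodule_injective ?_)
      change N.toSubmodule = ⊤
      rw [eq_top_iff, ← h v h0]
      refine Submodule.span_le.2 ?_
      rintro _ ⟨g, rfl⟩
      exact N.apply_mem_toSubmodule g hv

theorem exists_irreducible_sub [FiniteDimensional ℂ V] [Nontrivial V]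
    (ρ : Representation ℂ G V) :
    ∃ N : Subrepresentation ρ, N.toRepresentation.IsIrreducible := by
  classical
  have hex : ∃ n, ∃ v : V, v ≠ 0 ∧ finrank ℂ (cyclicSub ρ v).toSubmodule = n := by
    obtain ⟨v, hv⟩ := exists_ne (0 : V)
    exact ⟨_, v, hv, rfl⟩
  -- A nonzero vector whose cyclic span has least dimension generates an irreducible
  -- subrepresentation.
  obtain ⟨v, hv, hn⟩ := Nat.find_spec hex
  have hmin := fun w (hw : w ≠ 0) => Nat.find_min' hex ⟨w, hw, rfl⟩
  refine ⟨cyclicSub ρ v, ?_⟩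
  have : Nontrivial (cyclicSub ρ v).toSubmodule :=
    ⟨⟨⟨v, self_mem_cyclicSub ρ v⟩, 0, fun h => hv (congrArg Subtype.val h)⟩⟩
  refine isIrreducible_of_cyclic _ fun w hw => ?_
  have hw' : (w : V) ≠ 0 := fun h => hw (Subtype.ext h)
  have hle : (cyclicSub ρ (w : V)).toSubmodule ≤ (cyclicSub ρ v).toSubmodule := by
    refine Submodule.span_le.2 ?_
    rintro _ ⟨g, rfl⟩
    exact (cyclicSub ρ v).apply_mem_toSubmodule g w.2
  have heq := Submodule.eq_of_le_of_finrank_le hle (by rw [hn]; exact hmin w hw')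
  rw [eq_top_iff]
  intro x _
  have hx : (x : V) ∈ (cyclicSub ρ (w : V)).toSubmodule := heq.symm.le x.2
  have hmap : (cyclicSub ρ (w : V)).toSubmodule =
      (cyclicSub (cyclicSub ρ v).toRepresentation w).toSubmodule.map
        (cyclicSub ρ v).toSubmodule.subtype := by
    change Submodule.span _ _ = Submodule.map _ (Submodule.span _ _)
    rw [Submodule.map_span, ← Set.range_comp]
    rfl
  rw [hmap] at hx
  obtain ⟨y, hy, hyx⟩ := hx
  rwa [← Subtype.ext hyx]

/-- The span of the orbit of `(v, w)` in `V × W` has dimension at most the index of `S`. It surjects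
onto both factors by irreducibility, and these have exactly that dimension, so it is the graph of an
isomorphism. -/
theorem equiv_of_eigenvector [Finite G] {W : Type*} [AddCommGroup W] [Module ℂ W]
    [FiniteDimensional ℂ V] [FiniteDimensional ℂ W]
    (ρ : Representation ℂ G V) (σ : Representation ℂ G W) (hρ : ρ.IsIrreducible)
    (hσ : σ.IsIrreducible) (S : Subgroup G) {v : V} {w : W} (hv : v ≠ 0) (hw : w ≠ 0)
    (hS : ∀ s ∈ S, ∃ c : ℂ, ρ s v = c • v ∧ σ s w = c • w)
    (hV : finrank ℂ V = S.index) (hW : finrank ℂ W = S.index) : Nonempty (ρ.Equiv σ) := by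
  set U := cyclicSub (ρ.prod σ) (v, w) with hU
  have hle : finrank ℂ U.toSubmodule ≤ S.index := by
    refine finrank_cyclicSub_le _ _ S fun s hs => ?_
    obtain ⟨c, h1, h2⟩ := hS s hs
    exact ⟨c, Prod.ext h1 h2⟩
  have hmem : (v, w) ∈ U.toSubmodule := self_mem_cyclicSub _ _
  let f : U.toSubmodule →ₗ[ℂ] V := (LinearMap.fst ℂ V W).comp U.toSubmodule.subtype
  let g : U.toSubmodule →ₗ[ℂ] W := (LinearMap.snd ℂ V W).comp U.toSubmodule.subtype
  have hf : Function.Surjective f := by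
    rw [← LinearMap.range_eq_top]
    refine eq_top_of_stable ρ hρ _ ?_ (v := v) ⟨⟨_, hmem⟩, rfl⟩ hv
    rintro a _ ⟨x, rfl⟩
    exact ⟨⟨_, U.apply_mem_toSubmodule a x.2⟩, rfl⟩
  have hg : Function.Surjective g := by
    rw [← LinearMap.range_eq_top]
    refine eq_top_of_stable σ hσ _ ?_ (v := w) ⟨⟨_, hmem⟩, rfl⟩ hw
    rintro a _ ⟨x, rfl⟩
    exact ⟨⟨_, U.apply_mem_toSubmodule a x.2⟩, rfl⟩
  have e1 : finrank ℂ U.toSubmodule = finrank ℂ V :=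
    le_antisymm (hle.trans hV.ge) (LinearMap.finrank_le_finrank_of_surjective hf)
  have e2 : finrank ℂ U.toSubmodule = finrank ℂ W := e1.trans (hV.trans hW.symm)
  have hfi : Function.Injective f := (LinearMap.injective_iff_surjective_of_finrank_eq_finrank e1).2 hf
  have hgi : Function.Injective g := (LinearMap.injective_iff_surjective_of_finrank_eq_finrank e2).2 hg
  let ef : U.toRepresentation.Equiv ρ :=
    Representation.Equiv.mk (LinearEquiv.ofBijective f ⟨hfi, hf⟩) fun _ => rfl
  let eg : U.toRepresentation.Equiv σ :=
    Representation.Equiv.mk (LinearEquiv.ofBijective g ⟨hgi, hg⟩) fun _ => rfl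
  exact ⟨ef.symm.trans eg⟩

/-- A function with `c (s⁻¹)` inverse to the scalar of a functional gives an eigenvector by
averaging. -/
theorem exists_eigenvector_of_functional (ρ : Representation ℂ G V) (S : Subgroup G) [Finite S]
    (χ : S →* ℂ) (φ : V →ₗ[ℂ] ℂ) (hφ : ∀ (s : S) v, φ (ρ s v) = χ s * φ v) {v : V}
    (hv : φ v ≠ 0) :
    ∃ w ∈ Submodule.span ℂ (Set.range fun s : S => ρ s v),
      w ≠ 0 ∧ ∀ s : S, ρ s w = χ s • w := by
  have : Fintype S := Fintype.ofFinite _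
  have hχ : ∀ s : S, χ s * χ s⁻¹ = 1 := fun s => by rw [← map_mul]; simp
  refine ⟨∑ s : S, χ s⁻¹ • ρ s v,
    Submodule.sum_mem _ fun s _ => Submodule.smul_mem _ _ (Submodule.subset_span ⟨s, rfl⟩),
    fun h => ?_, fun t => ?_⟩
  · have h1 := congrArg φ h
    rw [map_sum, map_zero] at h1
    have : ∀ s : S, φ (χ s⁻¹ • ρ s v) = φ v := fun s => by
      rw [map_smul, hφ, smul_eq_mul, ← mul_assoc, mul_comm (χ s⁻¹), hχ, one_mul]
    rw [Finset.sum_congr rfl fun s _ => this s, Finset.sum_const, Finset.card_univ, nsmul_eq_mul] at h1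
    exact (mul_ne_zero (Nat.cast_ne_zero.2 Fintype.card_ne_zero) hv) h1
  · rw [map_sum, Finset.smul_sum]
    refine Fintype.sum_equiv (Equiv.mulLeft t) _ _ fun s => ?_
    rw [map_smul, Equiv.coe_mulLeft, mul_inv_rev, map_mul, smul_smul, mul_comm (χ s⁻¹),
      ← mul_assoc, hχ, one_mul, Subgroup.coe_mul, map_mul, Module.End.mul_apply]

/-- Frobenius reciprocity: induction embeds in coinduction, evaluation at `1` gives a functional
that `S` scales by `χ`, and averaging turns it into an eigenvector. -/
theorem IsIrrAbove.exists_eigenvector [Finite G] {ρ : Representation ℂ G V} {S : Subgroup G}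
    {χ : S →* ℂ} (h : IsIrrAbove ρ χ) : ∃ v, v ≠ 0 ∧ ∀ s : S, ρ s v = χ s • v := by
  classical
  obtain ⟨hρ, f, hf⟩ := h
  have : Nontrivial V := nontrivial_of_isIrreducible ρ hρ
  let F := (Rep.indToCoind (Rep.of (charRep χ)))
  have hF : Function.Injective F := by
    have := Rep.indToCoind_coindToInd (Rep.of (charRep χ))
    exact Function.LeftInverse.injective (g := Rep.coindToInd (Rep.of (charRep χ)))
      fun x => LinearMap.congr_fun this x
  have hFg : ∀ (g : G) x, F (Representation.ind S.subtype (charRep χ) g x) =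
      Representation.coind S.subtype (charRep χ) g (F x) := by
    intro g x
    have : F ∘ₗ Representation.ind S.subtype (charRep χ) g =
      Representation.coind S.subtype (charRep χ) g ∘ₗ F := by
      ext a b
      simp only [F, LinearMap.coe_comp, Function.comp_apply]
      simp
      exact Rep.indToCoindAux_fst_mul_inv (A := Rep.of (charRep χ)) a g b (1 : ℂ)
    exact LinearMap.congr_fun this x
  let φ : V →ₗ[ℂ] ℂ := LinearMap.proj 1 ∘ₗ Submodule.subtype _ ∘ₗ F ∘ₗ f.toLinearMap
  have hφ : ∀ g v, φ (ρ g v) = (F (f v)).1 g := by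
    intro g v
    change (F (f (ρ g v))).1 1 = _
    rw [f.isIntertwining, hFg]
    exact congrArg (F (f v)).1 (one_mul g)
  obtain ⟨v, hv⟩ := exists_ne (0 : V)
  have h0 : F (f v) ≠ 0 := fun h => hv (hf (hF (by rw [h]; simp)))
  obtain ⟨g, hg⟩ : ∃ g, (F (f v)).1 g ≠ 0 := by
    by_contra! hg
    exact h0 (Subtype.ext (funext hg))
  rw [← hφ] at hg
  obtain ⟨w, -, hw, h⟩ := exists_eigenvector_of_functional ρ S χ φ (fun s v => by
    have h1 := (F (f v)).2 s 1
    have h2 := hφ 1 v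
    rw [map_one, Module.End.one_apply] at h2
    rw [hφ, h2]
    rwa [mul_one] at h1) hg
  exact ⟨w, hw, h⟩

/-- The coinduced representation bounds the dimension: a nonzero vector of `Coind ρ` that is
scaled by a subgroup `S` forces `dim ρ ≤ [H : S]`. -/
theorem finrank_le_index_of_coind {H : Type*} [Group H] [Finite H] (ι : G →* H)
    (ρ : Representation ℂ G V) [FiniteDimensional ℂ V]
    (hρ : ρ.IsIrreducible) {w : Representation.coindV ι ρ} (hw : w ≠ 0) (S : Subgroup H)
    (hS : ∀ s ∈ S, ∃ c : ℂ, Representation.coind ι ρ s w = c • w) :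
    finrank ℂ V ≤ S.index := by
  refine le_trans ?_ (finrank_cyclicSub_le (Representation.coind ι ρ) w S hS)
  set U := cyclicSub (Representation.coind ι ρ) w
  -- Evaluation at `1` is `G`-equivariant and nonzero on the orbit span of `w`, hence onto the
  -- irreducible `V`.
  let φ : U.toSubmodule →ₗ[ℂ] V :=
    LinearMap.proj 1 ∘ₗ Submodule.subtype _ ∘ₗ U.toSubmodule.subtype
  have hφ : ∀ (h : H) (x : U.toSubmodule),
      φ ⟨_, U.apply_mem_toSubmodule h x.2⟩ = (x : Representation.coindV ι ρ).1 h := by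
    intro h x
    exact congrArg (x : Representation.coindV ι ρ).1 (one_mul h)
  obtain ⟨h, hh⟩ : ∃ h, w.1 h ≠ 0 := by
    by_contra! hg
    exact hw (Subtype.ext (funext hg))
  refine LinearMap.finrank_le_finrank_of_surjective (f := φ) ?_
  rw [← LinearMap.range_eq_top]
  refine eq_top_of_stable ρ hρ _ ?_ (v := w.1 h) ⟨_, hφ h ⟨w, self_mem_cyclicSub _ _⟩⟩ hh
  rintro g _ ⟨x, rfl⟩
  refine ⟨_, (hφ (ι g) x).trans ?_⟩
  have := (x : Representation.coindV ι ρ).2 g 1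
  rwa [mul_one] at this

end General

/-! ### Eigenvectors of the abelian congruence subgroup -/

section Eig

open Module

variable {R : Type*} [CommRing R] {Γ : Type*} [Group Γ] {V : Type*} [AddCommGroup V] [Module ℂ V]

local notation "M₂" => Matrix (Fin 2) (Fin 2)

/-- `v` is an eigenvector, with character `I + pB ↦ ψ (p tr (A B))`, of the elements of `Γ` that
act as matrices `I + pB` of determinant one. -/
def IsEig (μ : Γ →* M₂ R) (p : R) (ψ : AddChar R ℂ) (ρ : Representation ℂ Γ V) (A : M₂ R)
    (v : V) : Prop :=
  ∀ γ B, (μ γ).det = 1 → μ γ = 1 + p • B → ρ γ v = ψ (p * (A * B).trace) • v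

/-- The space of all `v` with `IsEig μ p ψ ρ A v`. -/
def eigSpace (μ : Γ →* M₂ R) (p : R) (ψ : AddChar R ℂ) (ρ : Representation ℂ Γ V) (A : M₂ R) :
    Submodule ℂ V where
  carrier := {v | IsEig μ p ψ ρ A v}
  add_mem' h h' γ B h1 h2 := by rw [map_add, h γ B h1 h2, h' γ B h1 h2, smul_add]
  zero_mem' γ B _ _ := by simp
  smul_mem' c v h γ B h1 h2 := by rw [map_smul, h γ B h1 h2, smul_comm]

/-- Equality of matrices modulo the annihilator of `p` and scalar matrices. -/
def Eqv (p : R) (A A' : M₂ R) : Prop := ∃ x : R, p • A = p • (A' + x • (1 : M₂ R))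

theorem map_mul_inv (μ : Γ →* M₂ R) (h : Γ) : μ h * μ h⁻¹ = 1 := by
  rw [← map_mul, mul_inv_cancel, map_one]

theorem map_inv_mul (μ : Γ →* M₂ R) (h : Γ) : μ h⁻¹ * μ h = 1 := by
  rw [← map_mul, inv_mul_cancel, map_one]

theorem det_map_mul_inv (μ : Γ →* M₂ R) (h : Γ) : (μ h).det * (μ h⁻¹).det = 1 := by
  rw [← Matrix.det_mul, map_mul_inv, Matrix.det_one]

variable {μ : Γ →* M₂ R} {p : R} {ψ : AddChar R ℂ} {ρ : Representation ℂ Γ V} {A A' : M₂ R} {v : V}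

theorem IsEig.conj (hv : IsEig μ p ψ ρ A v) (h : Γ) :
    IsEig μ p ψ ρ (μ h * A * μ h⁻¹) (ρ h v) := by
  intro γ B h1 h2
  have h3 : μ (h⁻¹ * γ * h) = 1 + p • (μ h⁻¹ * B * μ h) := by
    rw [map_mul, map_mul, h2, mul_add, add_mul, mul_one, map_inv_mul, Matrix.mul_smul,
      Matrix.smul_mul]
  have h4 : (μ (h⁻¹ * γ * h)).det = 1 := by
    rw [map_mul, map_mul, Matrix.det_mul, Matrix.det_mul, h1, mul_one, mul_comm, det_map_mul_inv]
  have h5 := hv _ _ h4 h3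
  have h6 : ρ γ (ρ h v) = ρ h (ρ (h⁻¹ * γ * h) v) := by
    rw [← Module.End.mul_apply, ← Module.End.mul_apply, ← map_mul, ← map_mul]
    congr 2
    group
  rw [h6, h5, map_smul]
  congr 3
  rw [← mul_assoc, ← mul_assoc, Matrix.trace_mul_comm, ← mul_assoc, ← mul_assoc]

/-- With `p² = 0`, `det(1 + pB) = 1 + p tr B`. This is why a scalar matrix contributes nothing to
the character. -/
theorem mul_trace_eq_zero_of_det (hp : p * p = 0) {B : M₂ R} (h : (1 + p • B).det = 1) :
    p * B.trace = 0 := by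
  rw [Matrix.det_fin_two] at h
  simp only [Matrix.add_apply, Matrix.smul_apply, Matrix.one_apply, smul_eq_mul] at h
  rw [Matrix.trace_fin_two]
  simp at h
  linear_combination h - (B 0 0 * B 1 1 - B 0 1 * B 1 0) * hp

theorem Eqv.mul_trace (hp : p * p = 0) (h : Eqv p A A') {B : M₂ R} (hB : (1 + p • B).det = 1) :
    p * (A * B).trace = p * (A' * B).trace := by
  obtain ⟨x, hx⟩ := h
  have h0 := mul_trace_eq_zero_of_det hp hB
  rw [← smul_eq_mul, ← Matrix.trace_smul, ← Matrix.smul_mul, hx, Matrix.smul_mul, add_mul,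
    Matrix.trace_smul, Matrix.trace_add, Matrix.smul_mul, one_mul, Matrix.trace_smul, smul_eq_mul,
    smul_eq_mul]
  linear_combination x * h0

theorem IsEig.congr (hp : p * p = 0) (hv : IsEig μ p ψ ρ A v) (h : Eqv p A A') :
    IsEig μ p ψ ρ A' v := by
  intro γ B h1 h2
  rw [hv γ B h1 h2, h.mul_trace hp (h2 ▸ h1)]

theorem IsEig.stable (hp : p * p = 0) (hv : IsEig μ p ψ ρ A v) {h : Γ}
    (hh : p • (μ h * A) = p • (A * μ h)) : IsEig μ p ψ ρ A (ρ h v) := by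
  refine (hv.conj h).congr hp ⟨0, ?_⟩
  rw [zero_smul, add_zero, ← Matrix.smul_mul, hh, Matrix.smul_mul, mul_assoc, map_mul_inv, mul_one]

/-- The commutator of `g` and `h` is `1 + pNm`, where `N` is built from commutators with polynomials
in `A`. Since `m` commutes with `A` modulo the annihilator of `p`, cyclicity of the trace gives `p
tr(ANm) = 0`, so the commutator fixes every vector of the eigenspace that the two elements preserve.
-/
theorem IsEig.commute (hp : p * p = 0) (hv : IsEig μ p ψ ρ A v) {g h : Γ} {a b a' b' : R}
    {X Y : M₂ R} (hg : μ g = a • (1 : M₂ R) + b • A + p • X)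
    (hh : μ h = a' • (1 : M₂ R) + b' • A + p • Y) :
    ρ g (ρ h v) = ρ h (ρ g v) := by
  have hgA : p • (μ g * A) = p • (A * μ g) := by
    rw [hg]
    simp only [add_mul, mul_add, smul_add, Matrix.smul_mul, Matrix.mul_smul, smul_smul, hp,
      zero_smul, one_mul, mul_one]
  have hhA : p • (μ h * A) = p • (A * μ h) := by
    rw [hh]
    simp only [add_mul, mul_add, smul_add, Matrix.smul_mul, Matrix.mul_smul, smul_smul, hp,
      zero_smul, one_mul, mul_one]
  set c := a • (1 : M₂ R) + b • A with hc
  set d := a' • (1 : M₂ R) + b' • A with hd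
  set m := μ (h * g)⁻¹ with hm
  have hmA : p • (m * A) = p • (A * m) := by
    have h1 : p • (μ (h * g) * A) = p • (A * μ (h * g)) := by
      rw [map_mul, mul_assoc, ← Matrix.mul_smul, hgA, Matrix.mul_smul, ← mul_assoc,
        ← Matrix.smul_mul, hhA, Matrix.smul_mul, mul_assoc]
    calc p • (m * A) = m * (p • (A * μ (h * g))) * m := by
          rw [Matrix.mul_smul, Matrix.smul_mul, mul_assoc, mul_assoc, map_mul_inv, mul_one]
      _ = p • (A * m) := by
          rw [← h1, Matrix.mul_smul, Matrix.smul_mul, ← mul_assoc, map_inv_mul, one_mul]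
  have hmc : ∀ x y : R, p • (m * (x • (1 : M₂ R) + y • A)) = p • ((x • (1 : M₂ R) + y • A) * m) := by
    intro x y
    simp only [add_mul, mul_add, smul_add, Matrix.smul_mul, Matrix.mul_smul, one_mul, mul_one]
    rw [smul_comm p y, hmA, smul_comm p y]
  have hcom : ∀ x y x' y' : R, (x • (1 : M₂ R) + y • A) * (x' • (1 : M₂ R) + y' • A) =
      (x' • (1 : M₂ R) + y' • A) * (x • (1 : M₂ R) + y • A) := by
    intro x y x' y'
    simp only [add_mul, mul_add, Matrix.smul_mul, Matrix.mul_smul, one_mul, mul_one, smul_smul]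
    rw [mul_comm x, mul_comm x, mul_comm y, mul_comm y]
    abel
  have hcA : ∀ x y : R, (x • (1 : M₂ R) + y • A) * A = A * (x • (1 : M₂ R) + y • A) := by
    intro x y
    simp only [add_mul, mul_add, Matrix.smul_mul, Matrix.mul_smul, one_mul, mul_one]
  set N := c * Y - Y * c + (X * d - d * X) with hN
  have hγ : μ (g * h * (h * g)⁻¹) = 1 + p • (N * m) := by
    have h1 : μ (g * h) = μ (h * g) + p • N := by
      rw [map_mul, map_mul, hg, hh, hN]
      simp only [add_mul, mul_add, smul_add, Matrix.smul_mul, Matrix.mul_smul, smul_smul, hp,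
        zero_smul, smul_sub]
      rw [hcom a b a' b']
      abel
    rw [map_mul, h1, add_mul, map_mul_inv, Matrix.smul_mul]
  have hdet : (μ (g * h * (h * g)⁻¹)).det = 1 := by
    rw [map_mul, map_mul, Matrix.det_mul, Matrix.det_mul, mul_comm (μ g).det, ← Matrix.det_mul,
      ← map_mul, det_map_mul_inv]
  have htr : ∀ (x y : R) (Z : M₂ R),
      p * (A * ((x • (1 : M₂ R) + y • A) * Z * m)).trace =
        p * (A * (Z * (x • (1 : M₂ R) + y • A) * m)).trace := by
    intro x y Z
    set w := x • (1 : M₂ R) + y • A with hw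
    have e1 : (A * (w * Z * m)).trace = (m * A * w * Z).trace := by
      rw [← mul_assoc, Matrix.trace_mul_comm]; simp only [mul_assoc]
    have e2 : (A * (Z * w * m)).trace = (w * m * A * Z).trace := by
      have : A * (Z * w * m) = A * Z * (w * m) := by simp only [mul_assoc]
      rw [this, Matrix.trace_mul_comm]; simp only [mul_assoc]
    have e3 : ∀ M : M₂ R, p * M.trace = (p • M).trace := fun M => by
      rw [Matrix.trace_smul, smul_eq_mul]
    rw [e1, e2, e3, e3,
      ← Matrix.smul_mul p _ Z, ← Matrix.smul_mul p _ Z, mul_assoc m, ← hcA, ← mul_assoc,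
      ← Matrix.smul_mul p _ A, hmc, Matrix.smul_mul p _ A]
  have h0 : p * (A * (N * m)).trace = 0 := by
    have e1 := htr a b Y
    have e2 := htr a' b' X
    rw [← hc] at e1
    rw [← hd] at e2
    have : A * (N * m) = A * (c * Y * m) - A * (Y * c * m) + (A * (X * d * m) - A * (d * X * m)) := by
      rw [hN]; simp only [add_mul, mul_add, sub_mul, mul_sub]
    rw [this, Matrix.trace_add, Matrix.trace_sub, Matrix.trace_sub]
    linear_combination e1 - e2
  have hs : IsEig μ p ψ ρ A (ρ h (ρ g v)) := (hv.stable hp hgA).stable hp hhA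
  have h1 := hs _ _ hdet hγ
  rw [h0, AddChar.map_zero_eq_one, one_smul, ← Module.End.mul_apply (ρ h), ← map_mul,
    ← Module.End.mul_apply, ← map_mul, inv_mul_cancel_right] at h1
  rw [← Module.End.mul_apply, ← map_mul, h1, map_mul, Module.End.mul_apply]

/-- Testing on elementary nilpotent matrices recovers the off-diagonal entries. The diagonal test
`diag(y, -y)` sees only the difference of the diagonal entries, which leaves the scalar free. -/
theorem IsEig.eqv (hp : p * p = 0) (hψ : ∀ t : R, (∀ x, ψ (t * x) = 1) → t = 0)
    (hμ : ∀ M : M₂ R, M.det = 1 → ∃ γ, μ γ = M) (h0 : v ≠ 0) (hv : IsEig μ p ψ ρ A v)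
    (hv' : IsEig μ p ψ ρ A' v) : Eqv p A A' := by
  have key : ∀ B : M₂ R, (1 + p • B).det = 1 → ψ (p * ((A - A') * B).trace) = 1 := by
    intro B hB
    obtain ⟨γ, hγ⟩ := hμ _ hB
    have h1 := hv γ B (hγ ▸ hB) hγ
    rw [hv' γ B (hγ ▸ hB) hγ] at h1
    have h2 := smul_left_injective ℂ h0 h1
    rw [sub_mul, Matrix.trace_sub, mul_sub, AddChar.map_sub_eq_div, h2, div_self]
    intro h3
    have h4 := AddChar.map_sub_eq_div ψ (p * (A * B).trace) (p * (A * B).trace)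
    rw [sub_self, h3, AddChar.map_zero_eq_one, div_zero] at h4
    exact one_ne_zero h4
  have h1 : p * (A - A') 1 0 = 0 := hψ _ fun y => by
    have := key !![0, y; 0, 0] (by simp [Matrix.det_fin_two])
    simpa [Matrix.trace_fin_two, Matrix.mul_apply, Fin.sum_univ_two, mul_assoc] using this
  have h2 : p * (A - A') 0 1 = 0 := hψ _ fun y => by
    have := key !![0, 0; y, 0] (by simp [Matrix.det_fin_two])
    simpa [Matrix.trace_fin_two, Matrix.mul_apply, Fin.sum_univ_two, mul_assoc] using this
  have h3 : p * ((A - A') 0 0 - (A - A') 1 1) = 0 := hψ _ fun y => by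
    have := key !![y, 0; 0, -y] (by
      simp [Matrix.det_fin_two]; linear_combination -y * y * hp)
    rw [Matrix.trace_fin_two, Matrix.mul_apply, Matrix.mul_apply, Fin.sum_univ_two,
      Fin.sum_univ_two] at this
    simp only [Matrix.of_apply, Matrix.cons_val', Matrix.cons_val_zero, Matrix.cons_val_one,
      Matrix.cons_val_fin_one] at this
    rw [← this]
    congr 1
    ring
  rw [Matrix.sub_apply] at h1 h2 h3
  rw [Matrix.sub_apply] at h3
  refine ⟨A 1 1 - A' 1 1, ?_⟩
  ext i j
  fin_cases i <;> fin_cases j <;> simp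
  · linear_combination h3
  · linear_combination h2
  · linear_combination h1

theorem Eqv.conj (h : Eqv p A A') (g : Γ) :
    Eqv p (μ g * A * μ g⁻¹) (μ g * A' * μ g⁻¹) := by
  obtain ⟨x, hx⟩ := h
  refine ⟨x, ?_⟩
  rw [← Matrix.smul_mul, ← Matrix.mul_smul, hx, Matrix.mul_smul, Matrix.smul_mul, mul_add, add_mul,
    Matrix.mul_smul, Matrix.smul_mul, mul_one, map_mul_inv]

/-- The operators of the congruence subgroup commute, and joint eigenspaces with distinct systems of
eigenvalues are independent. -/
theorem linearIndependent_of_isEig (hp : p * p = 0)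
    (hψ : ∀ t : R, (∀ x, ψ (t * x) = 1) → t = 0)
    (hμ : ∀ M : M₂ R, M.det = 1 → ∃ γ, μ γ = M) (hμi : Function.Injective μ) {ι : Type*}
    {w : ι → V} {a : ι → M₂ R} (hw : ∀ i, w i ≠ 0) (h : ∀ i, IsEig μ p ψ ρ (a i) (w i))
    (ha : ∀ i j, Eqv p (a i) (a j) → i = j) : LinearIndependent ℂ w := by
  let K := {x : Γ × M₂ R // (μ x.1).det = 1 ∧ μ x.1 = 1 + p • x.2}
  let T : K → End ℂ V := fun x => ρ x.1.1
  let χ : ι → K → ℂ := fun i x => ψ (p * (a i * x.1.2).trace)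
  have hcomm : ∀ x y : K, Commute (T x) (T y) := by
    intro x y
    have : x.1.1 * y.1.1 = y.1.1 * x.1.1 := by
      apply hμi
      rw [map_mul, map_mul, x.2.2, y.2.2]
      simp only [add_mul, mul_add, Matrix.smul_mul, Matrix.mul_smul, smul_smul, hp, zero_smul,
        one_mul, mul_one]
      abel
    change ρ _ * ρ _ = ρ _ * ρ _
    rw [← map_mul, this, map_mul]
  have hind := End.independent_iInf_maxGenEigenspace_of_forall_mapsTo T
    fun i j c => End.mapsTo_maxGenEigenspace_of_comm (hcomm j i) c
  have hmem : ∀ i, w i ∈ ⨅ x, (T x).maxGenEigenspace (χ i x) := by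
    intro i
    rw [Submodule.mem_iInf]
    intro x
    refine End.mem_maxGenEigenspace _ _ _ |>.2 ⟨1, ?_⟩
    rw [pow_one, LinearMap.sub_apply, sub_eq_zero]
    exact h i _ _ x.2.1 x.2.2
  have hinj : Function.Injective χ := by
    intro i j hij
    refine ha i j (IsEig.eqv (v := w j) hp hψ hμ (hw j) ?_ (h j))
    intro γ B h1 h2
    rw [h j γ B h1 h2]
    exact congrArg (· • w j) (congrFun hij ⟨(γ, B), h1, h2⟩).symm
  exact (hind.comp hinj).linearIndependent _ (fun i => hmem i) hw

end Eig

/-! ### Isotypic projections and irreducibles containing a given character -/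

section General

open Module

variable {G : Type*} [Group G] {V : Type*} [AddCommGroup V] [Module ℂ V]

/-- `P` is the unnormalised average `∑ χ(s)⁻¹ ρ(s)`, which explains the factor `Nat.card S`. -/
theorem exists_projection (ρ : Representation ℂ G V) (S : Subgroup G) [Finite S] (χ : S →* ℂ) :
    ∃ P : End ℂ V, (∀ (s : S) v, P (ρ s v) = χ s • P v) ∧ (∀ (s : S) v, ρ s (P v) = χ s • P v) ∧
      ∀ v, (∀ s : S, ρ s v = χ s • v) → P v = (Nat.card S : ℂ) • v := by
  have : Fintype S := Fintype.ofFinite _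
  have hχ : ∀ s : S, χ s * χ s⁻¹ = 1 := fun s => by rw [← map_mul]; simp
  refine ⟨∑ s : S, χ s⁻¹ • ρ s, fun t v => ?_, fun t v => ?_, fun v hv => ?_⟩
  · rw [LinearMap.sum_apply, LinearMap.sum_apply, Finset.smul_sum]
    refine Fintype.sum_equiv (Equiv.mulRight t) _ _ fun s => ?_
    rw [Equiv.coe_mulRight, LinearMap.smul_apply, LinearMap.smul_apply, mul_inv_rev, map_mul,
      smul_smul, ← mul_assoc, hχ, one_mul, Subgroup.coe_mul, map_mul, Module.End.mul_apply]
  · rw [LinearMap.sum_apply, map_sum, Finset.smul_sum]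
    refine Fintype.sum_equiv (Equiv.mulLeft t) _ _ fun s => ?_
    rw [Equiv.coe_mulLeft, LinearMap.smul_apply, LinearMap.smul_apply, map_smul, mul_inv_rev,
      map_mul, smul_smul, mul_comm (χ s⁻¹), ← mul_assoc, hχ, one_mul, Subgroup.coe_mul, map_mul,
      Module.End.mul_apply]
  · have h : ∀ s : S, (χ s⁻¹ • ρ s) v = v := fun s => by
      rw [LinearMap.smul_apply, hv, smul_smul, mul_comm, hχ, one_smul]
    rw [LinearMap.sum_apply, Finset.sum_congr rfl fun s _ => h s, Finset.sum_const,
      Finset.card_univ, Nat.card_eq_fintype_card, Nat.cast_smul_eq_nsmul]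

theorem isIrreducible_of_equiv {W : Type*} [AddCommGroup W] [Module ℂ W]
    {ρ : Representation ℂ G V} {σ : Representation ℂ G W} (e : ρ.Equiv σ) (hρ : ρ.IsIrreducible) :
    σ.IsIrreducible := by
  have hV := nontrivial_of_isIrreducible ρ hρ
  have : Nontrivial W := e.toLinearEquiv.symm.toEquiv.nontrivial
  refine isIrreducible_of_cyclic σ fun w hw => ?_
  obtain ⟨v, rfl⟩ := e.toLinearEquiv.surjective w
  have hv : v ≠ 0 := fun h => hw (by rw [h, map_zero])
  have h : (cyclicSub σ (e.toLinearEquiv v)).toSubmodule =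
      (cyclicSub ρ v).toSubmodule.map e.toLinearEquiv.toLinearMap := by
    change Submodule.span _ _ = Submodule.map _ (Submodule.span _ _)
    rw [Submodule.map_span, ← Set.range_comp]
    congr 2
    ext g
    exact (e.toIntertwiningMap.isIntertwining _ _ g v).symm
  rw [h, cyclicSub_eq_top ρ hρ hv, Submodule.map_top, LinearEquiv.range]

theorem exists_equiv_fin [FiniteDimensional ℂ V] (ρ : Representation ℂ G V) {d : ℕ}
    (hd : finrank ℂ V = d) :
    ∃ σ : Representation ℂ G (Fin d → ℂ), Nonempty (ρ.Equiv σ) := by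
  subst hd
  let e : V ≃ₗ[ℂ] (Fin (finrank ℂ V) → ℂ) := (finBasis ℂ V).equivFun
  refine ⟨e.conjRingEquiv.toMonoidHom.comp ρ, ⟨Representation.Equiv.mk e fun g => ?_⟩⟩
  ext v
  simp

theorem exists_irreducible_of_character [Finite G] (S : Subgroup G) (χ : S →* ℂ) :
    ∃ (d : ℕ) (σ : Representation ℂ G (Fin d → ℂ)), σ.IsIrreducible ∧
      ∃ v, v ≠ 0 ∧ ∀ s : S, σ s v = χ s • v := by
  classical
  set W := Representation.coindV S.subtype (charRep χ)
  set ρ := Representation.coind S.subtype (charRep χ)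
  -- Extending `χ` by zero shows that the coinduced space is nonzero; any irreducible inside it
  -- carries evaluation at `1`, on which `S` acts by `χ`.
  let F : G → ℂ := fun x => if h : x ∈ S then χ ⟨x, h⟩ else 0
  have hF : ∀ (s : S) x, F (s * x) = χ s * F x := by
    intro s x
    by_cases hx : x ∈ S
    · simp only [F]
      rw [dif_pos hx, dif_pos (S.mul_mem s.2 hx), ← map_mul]; rfl
    · simp only [F]
      rw [dif_neg hx, dif_neg (fun h => hx ((S.mul_mem_cancel_left s.2).1 h)), mul_zero]
  have : Nontrivial W := by
    refine ⟨⟨⟨F, hF⟩, 0, fun h => ?_⟩⟩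
    have : F 1 = 0 := congrFun (congrArg Subtype.val h) 1
    simp only [F, S.one_mem, dite_true] at this
    exact one_ne_zero ((map_one χ).symm.trans this)
  obtain ⟨N, hN⟩ := exists_irreducible_sub ρ
  have := nontrivial_of_isIrreducible _ hN
  obtain ⟨n, hn⟩ := exists_ne (0 : N.toSubmodule)
  obtain ⟨g, hg⟩ : ∃ g, n.1.1 g ≠ 0 := by
    by_contra! hg
    exact hn (Subtype.ext (Subtype.ext (funext hg)))
  let φ : N.toSubmodule →ₗ[ℂ] ℂ :=
    LinearMap.proj 1 ∘ₗ Submodule.subtype _ ∘ₗ N.toSubmodule.subtype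
  have hφ : ∀ g x, φ (N.toRepresentation g x) = x.1.1 g := fun g x => congrArg x.1.1 (one_mul g)
  rw [← hφ] at hg
  have hφS : ∀ (s : S) x, φ (N.toRepresentation s x) = χ s * φ x := by
    intro s x
    have := x.1.2 s 1
    rw [mul_one] at this
    rw [hφ]
    exact this
  obtain ⟨w, -, hw, h⟩ := exists_eigenvector_of_functional (V := N.toSubmodule)
    N.toRepresentation S χ φ hφS (v := N.toRepresentation g n) hg
  obtain ⟨σ, ⟨e⟩⟩ := exists_equiv_fin (V := N.toSubmodule) N.toRepresentation rfl
  refine ⟨_, σ, isIrreducible_of_equiv e hN, e.toLinearEquiv w, ?_, fun s => ?_⟩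
  · simpa using hw
  · have := e.toIntertwiningMap.isIntertwining _ _ s w
    rw [h, map_smul] at this
    exact this.symm

end General

/-! ### The finite ring, its self-duality, and the group diagonal modulo `p` -/

section Level

open Module

local notation "M₂" => Matrix (Fin 2) (Fin 2)
local notation "SL₂" => Matrix.SpecialLinearGroup (Fin 2)

/-- The properties of `R = 𝔬_{2ℓ}`, `p = π ^ ℓ`, `s = π ^ (2ℓ - 1)`, the reduction `f` to the
residue field and the additive character `ψ`. -/
structure Level {R k : Type*} [CommRing R] [Field k] (f : R →+* k) (p s : R)
    (ψ : AddChar R ℂ) : Prop where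
  surjective : Function.Surjective f
  isUnit : ∀ x, f x ≠ 0 → IsUnit x
  sq : p * p = 0
  dvd_of_mul : ∀ y, p * y = 0 → p ∣ y
  dvd : p ∣ s
  socle : ∀ x, f x = 0 → s * x = 0
  dvd_socle : ∀ t, t ≠ 0 → t ∣ s
  psi_ne : ψ s ≠ 1
  two : ¬ p ∣ 2

variable {R k : Type*} [CommRing R] [Field k] {f : R →+* k} {p s : R} {ψ : AddChar R ℂ}

theorem Level.nondegenerate (L : Level f p s ψ) (t : R) (h : ∀ x, ψ (t * x) = 1) : t = 0 := by
  by_contra ht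
  obtain ⟨x, hx⟩ := L.dvd_socle t ht
  exact L.psi_ne (hx ▸ h x)

theorem Level.map_p (L : Level f p s ψ) : f p = 0 := by
  have := congrArg f L.sq
  rwa [map_mul, map_zero, mul_self_eq_zero] at this

theorem Level.map_s (L : Level f p s ψ) : f s = 0 := by
  obtain ⟨c, hc⟩ := L.dvd
  rw [hc, map_mul, L.map_p, zero_mul]

/-- By nondegeneracy `t ↦ ψ(t ·)` is injective into a dual group of the same finite order. -/
theorem Level.exists_psi_mul [Finite R] (L : Level f p s ψ) (χ : AddChar R ℂ) :
    ∃ t, ∀ y, χ y = ψ (t * y) := by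
  classical
  have : Fintype R := Fintype.ofFinite _
  have hinj : Function.Injective fun t : R => ψ.mulShift t := by
    intro t t' h
    refine sub_eq_zero.1 (L.nondegenerate _ fun x => ?_)
    have h1 : ψ (t * x) = ψ (t' * x) := DFunLike.congr_fun h x
    rw [sub_mul, AddChar.map_sub_eq_div, h1, div_self]
    exact (AddChar.val_isUnit ψ _).ne_zero
  have hbij := (Fintype.bijective_iff_injective_and_card _).2 ⟨hinj, AddChar.card_eq.symm⟩
  obtain ⟨t, ht⟩ := hbij.2 χ
  exact ⟨t, fun y => by rw [← ht]; rfl⟩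

/-- Triviality on `pR` puts the parameter in the annihilator of `p`, which is `pR`. -/
theorem Level.exists_psi_mul_mul [Finite R] (L : Level f p s ψ) (χ : AddChar R ℂ)
    (hχ : ∀ y, χ (p * y) = 1) : ∃ t, ∀ y, χ y = ψ (p * (t * y)) := by
  obtain ⟨t, ht⟩ := L.exists_psi_mul χ
  have h0 : p * t = 0 := L.nondegenerate _ fun x => by
    rw [← hχ x, ht, mul_left_comm, mul_assoc]
  obtain ⟨t', rfl⟩ := L.dvd_of_mul t h0
  exact ⟨t', fun y => by rw [ht, mul_assoc]⟩

/-- The matrix of an element of `SL₂`. -/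
def slMat (R : Type*) [CommRing R] : SL₂ R →* M₂ R where
  toFun g := g
  map_one' := rfl
  map_mul' _ _ := rfl

@[simp] theorem slMat_apply (g : SL₂ R) : slMat R g = g := rfl

theorem slMat_injective : Function.Injective (slMat R) := Subtype.val_injective

theorem slMat_surj (M : M₂ R) (h : M.det = 1) : ∃ γ, slMat R γ = M := ⟨⟨M, h⟩, rfl⟩

/-- The subgroup of matrices that are diagonal modulo `p`. -/
def diagSubgroup (p : R) : Subgroup (SL₂ R) where
  carrier := {g | p ∣ g 0 1 ∧ p ∣ g 1 0}
  one_mem' := by simp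
  mul_mem' {g h} hg hh := by
    simp only [Set.mem_ofPred_eq, Matrix.SpecialLinearGroup.coe_mul, Matrix.mul_apply,
      Fin.sum_univ_two] at *
    exact ⟨dvd_add (hh.1.mul_left _) (hg.1.mul_right _), dvd_add (hg.2.mul_right _) (hh.2.mul_left _)⟩
  inv_mem' {g} hg := by
    rw [Matrix.SpecialLinearGroup.SL2_inv_expl]
    exact ⟨(dvd_neg.2 hg.1 : p ∣ -(g 0 1)), (dvd_neg.2 hg.2 : p ∣ -(g 1 0))⟩

theorem mem_diagSubgroup {g : SL₂ R} : g ∈ diagSubgroup p ↔ p ∣ g 0 1 ∧ p ∣ g 1 0 := Iff.rfl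

theorem mul_apply_of_mem (hp : p * p = 0) {g : SL₂ R} (hg : g ∈ diagSubgroup p) :
    g 0 0 * g 1 1 = 1 := by
  obtain ⟨⟨x, hx⟩, y, hy⟩ := hg
  have := g.det_coe
  rw [Matrix.det_fin_two, hx, hy] at this
  linear_combination this + x * y * hp

/-- The unit `g₀₀` of a matrix `g` which is diagonal modulo `p`. -/
def diagUnit (hp : p * p = 0) : diagSubgroup p →* Rˣ where
  toFun g := ⟨g.1 0 0, g.1 1 1, mul_apply_of_mem hp g.2, by rw [mul_comm, mul_apply_of_mem hp g.2]⟩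
  map_one' := by ext; simp
  map_mul' g h := by
    ext
    obtain ⟨x, hx⟩ := g.2.1
    obtain ⟨y, hy⟩ := h.2.2
    simp only [Subgroup.coe_mul, Matrix.SpecialLinearGroup.coe_mul, Matrix.mul_apply,
      Fin.sum_univ_two, Units.val_mul]
    rw [hx, hy]
    linear_combination x * y * hp

theorem diagUnit_val (hp : p * p = 0) (g : diagSubgroup p) :
    (diagUnit hp g : R) = g.1 0 0 := rfl

/-- The character `g ↦ τ (g₀₀)` of the group of matrices that are diagonal modulo `p`. -/
def theta (hp : p * p = 0) (τ : Rˣ →* ℂˣ) : diagSubgroup p →* ℂ :=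
  (Units.coeHom ℂ).comp (τ.comp (diagUnit hp))

theorem theta_apply (hp : p * p = 0) (τ : Rˣ →* ℂˣ) (g : diagSubgroup p) :
    theta hp τ g = τ (diagUnit hp g) := rfl

/-- The diagonal matrix with entries `u`, `u⁻¹`. -/
def torus : Rˣ →* SL₂ R where
  toFun u := ⟨!![(u : R), 0; 0, (u⁻¹ : Rˣ)], by simp [Matrix.det_fin_two]⟩
  map_one' := by ext i j; fin_cases i <;> fin_cases j <;> simp
  map_mul' u v := by
    apply Subtype.ext
    change (!![((u * v : Rˣ) : R), 0; 0, ((u * v)⁻¹ : Rˣ)] : M₂ R) =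
      !![(u : R), 0; 0, (u⁻¹ : Rˣ)] * !![(v : R), 0; 0, (v⁻¹ : Rˣ)]
    simp [mul_comm]

theorem torus_mem (u : Rˣ) : torus u ∈ diagSubgroup p := by
  exact ⟨dvd_zero p, dvd_zero p⟩

/-- A matrix conjugating a diagonal matrix to a diagonal matrix modulo `p` and scalars is diagonal
or antidiagonal modulo `p`. -/
theorem Level.mem_or_of_eqv (L : Level f p s ψ) {g : SL₂ R} {a b a' b' : R} (hab : f a ≠ f b)
    (hab' : f a' ≠ f b')
    (h : Eqv p (slMat R g * !![a', 0; 0, b'] * slMat R g⁻¹) !![a, 0; 0, b]) :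
    g ∈ diagSubgroup p ∨ p ∣ g 0 0 ∧ p ∣ g 1 1 ∧ p * (a + a' - b - b') = 0 := by
  obtain ⟨x, hx⟩ := h
  have hx' : p • (slMat R g * !![a', 0; 0, b']) =
      p • ((!![a, 0; 0, b] + x • (1 : M₂ R)) * slMat R g) := by
    rw [← Matrix.smul_mul p _ (slMat R g), ← hx, Matrix.smul_mul, mul_assoc, map_inv_mul, mul_one]
  have h00 := congrFun (congrFun hx' 0) 0
  have h01 := congrFun (congrFun hx' 0) 1
  have h10 := congrFun (congrFun hx' 1) 0
  have h11 := congrFun (congrFun hx' 1) 1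
  simp [Matrix.mul_apply, Fin.sum_univ_two] at h00 h01 h10 h11
  have hu : ∀ {y z : R}, f y ≠ f z → ∀ {w}, p * ((y - z) * w) = 0 → p ∣ w := by
    intro y z hyz w hw
    obtain ⟨u, hu⟩ := L.isUnit (y - z) (by rwa [map_sub, sub_ne_zero])
    refine L.dvd_of_mul w ((u.mul_right_eq_zero).1 ?_)
    rw [hu]; linear_combination hw
  -- If `g₀₀` is not a unit, `det g = 1` makes both off-diagonal entries units. They determine the
  -- scalar `x`, and the two determinations of it must agree, which gives the last conclusion.
  by_cases h0 : f (g 0 0) = 0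
  · right
    have hdet := congrArg f g.det_coe
    rw [Matrix.det_fin_two, map_sub, map_mul, map_mul, h0, zero_mul, zero_sub, map_one] at hdet
    have hB : f (g 0 1) ≠ 0 := fun h => by rw [h] at hdet; simp at hdet
    have hC : f (g 1 0) ≠ 0 := fun h => by rw [h] at hdet; simp at hdet
    have eB : p * (b' - a - x) = 0 := ((L.isUnit _ hB).mul_left_eq_zero).1
      (by linear_combination h01)
    have eC : p * (a' - b - x) = 0 := ((L.isUnit _ hC).mul_left_eq_zero).1
      (by linear_combination h10)
    refine ⟨hu hab' (w := g 0 0) ?_, hu hab (w := g 1 1) ?_, by linear_combination eC - eB⟩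
    · linear_combination h00 - g 0 0 * eB
    · linear_combination h11 + g 1 1 * (- eB)
  · left
    have eA : p * (a' - a - x) = 0 := ((L.isUnit _ h0).mul_left_eq_zero).1
      (by linear_combination h00)
    refine ⟨hu hab'.symm (w := g 0 1) ?_, hu hab (w := g 1 0) ?_⟩
    · linear_combination h01 - g 0 1 * eA
    · linear_combination h10 - g 1 0 * eA

/-- The antidiagonal alternative would give `2p(a - b) = 0` with `a - b` a unit, hence `p ∣ 2`. -/
theorem Level.mem_of_eqv (L : Level f p s ψ) {g : SL₂ R} {a b : R} (hab : f a ≠ f b)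
    (h : Eqv p (slMat R g * !![a, 0; 0, b] * slMat R g⁻¹) !![a, 0; 0, b]) :
    g ∈ diagSubgroup p := by
  rcases L.mem_or_of_eqv hab hab h with h | ⟨-, -, h⟩
  · exact h
  · exfalso
    apply L.two
    obtain ⟨u, hu⟩ := L.isUnit (a - b) (by rwa [map_sub, sub_ne_zero])
    refine L.dvd_of_mul 2 ((u.mul_left_eq_zero).1 ?_)
    rw [hu]; linear_combination h

variable {V : Type*} [AddCommGroup V] [Module ℂ V] {ρ : Representation ℂ (SL₂ R) V} {v : V}

/-- Translates of `v` along different cosets have inequivalent matrices, so they are linearly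
independent. -/
theorem Level.index_le_finrank (L : Level f p s ψ) [Finite R] [FiniteDimensional ℂ V] {a b : R}
    (hab : f a ≠ f b) (hv : IsEig (slMat R) p ψ ρ !![a, 0; 0, b] v) (h0 : v ≠ 0) :
    (diagSubgroup p).index ≤ finrank ℂ V := by
  have : Fintype (SL₂ R ⧸ diagSubgroup p) := Fintype.ofFinite _
  have h := linearIndependent_of_isEig (ρ := ρ) (ι := SL₂ R ⧸ diagSubgroup p)
    (w := fun x => ρ x.out v)
    (a := fun x => slMat R x.out * !![a, 0; 0, b] * slMat R x.out⁻¹) L.sq L.nondegenerate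
    slMat_surj slMat_injective (fun x hx => h0 ?_) (fun x => hv.conj _) (fun x y hxy => ?_)
  · rw [Subgroup.index, Nat.card_eq_fintype_card]
    exact h.fintype_card_le_finrank
  · have := congrArg (ρ x.out⁻¹) hx
    rwa [← Module.End.mul_apply, ← map_mul, inv_mul_cancel, map_one, map_zero] at this
  · have h1 := hxy.conj (μ := slMat R) y.out⁻¹
    have h2 : y.out⁻¹ * x.out ∈ diagSubgroup p := by
      refine L.mem_of_eqv hab ?_
      convert h1 using 1
      · rw [mul_inv_rev, inv_inv, map_mul, map_mul]
        simp only [mul_assoc]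
      · rw [inv_inv, mul_assoc, mul_assoc, map_inv_mul, mul_one, ← mul_assoc, map_inv_mul, one_mul]
    rw [← QuotientGroup.eq] at h2
    rw [← x.out_eq', ← y.out_eq']
    exact h2.symm

end Level

/-! ### Characters of the group diagonal modulo `p` -/

section Theta

open Module

local notation "M₂" => Matrix (Fin 2) (Fin 2)
local notation "SL₂" => Matrix.SpecialLinearGroup (Fin 2)

theorem exists_character {H G V : Type*} [Group H] [Group G] [AddCommGroup V] [Module ℂ V]
    (φ : H →* G) (ρ : Representation ℂ G V) {v : V} (h0 : v ≠ 0)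
    (h : ∀ x, ∃ c : ℂ, ρ (φ x) v = c • v) :
    ∃ χ : H →* ℂ, ∀ x, ρ (φ x) v = χ x • v := by
  choose c hc using h
  refine ⟨⟨⟨c, smul_left_injective ℂ h0 ?_⟩, fun x y => smul_left_injective ℂ h0 ?_⟩, hc⟩
  · change c 1 • v = (1 : ℂ) • v
    rw [← hc, map_one, map_one, one_smul, Module.End.one_apply]
  · change c (x * y) • v = (c x * c y) • v
    rw [← hc, map_mul, map_mul, Module.End.mul_apply, hc, map_smul, hc, smul_smul, mul_comm]

variable {R k : Type*} [CommRing R] [Field k] {f : R →+* k} {p s : R} {ψ : AddChar R ℂ}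
  {V : Type*} [AddCommGroup V] [Module ℂ V] {ρ : Representation ℂ (SL₂ R) V} {v v' : V}
  {τ τ' : Rˣ →* ℂˣ}

/-- The homomorphism `y ↦ 1 + p y`. -/
def onePlus (hp : p * p = 0) : Multiplicative R →* Rˣ where
  toFun y := ⟨1 + p * y.toAdd, 1 - p * y.toAdd,
    by linear_combination -y.toAdd * y.toAdd * hp, by linear_combination -y.toAdd * y.toAdd * hp⟩
  map_one' := by ext; simp
  map_mul' x y := by
    ext
    simp only [toAdd_mul, Units.val_mul]
    linear_combination -x.toAdd * y.toAdd * hp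

/-- The upper unitriangular matrix with entry `p y`. -/
def upper (p : R) : Multiplicative R →* SL₂ R where
  toFun y := ⟨!![1, p * y.toAdd; 0, 1], by simp [Matrix.det_fin_two]⟩
  map_one' := by ext i j; fin_cases i <;> fin_cases j <;> simp
  map_mul' x y := by
    apply Subtype.ext
    change (!![1, p * (x * y).toAdd; 0, 1] : M₂ R) =
      !![1, p * x.toAdd; 0, 1] * !![1, p * y.toAdd; 0, 1]
    simp [mul_add, add_comm]

/-- The lower unitriangular matrix with entry `p y`. -/
def lower (p : R) : Multiplicative R →* SL₂ R where
  toFun y := ⟨!![1, 0; p * y.toAdd, 1], by simp [Matrix.det_fin_two]⟩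
  map_one' := by ext i j; fin_cases i <;> fin_cases j <;> simp
  map_mul' x y := by
    apply Subtype.ext
    change (!![1, 0; p * (x * y).toAdd, 1] : M₂ R) =
      !![1, 0; p * x.toAdd, 1] * !![1, 0; p * y.toAdd, 1]
    simp [mul_add]

/-- `v` is an eigenvector of the matrices that are diagonal modulo `p`, with character
`g ↦ τ (g₀₀)`. -/
def HasTheta (hp : p * p = 0) (τ : Rˣ →* ℂˣ) (ρ : Representation ℂ (SL₂ R) V) (v : V) : Prop :=
  ∀ g : diagSubgroup p, ρ g v = theta hp τ g • v

/-- `τ` is nontrivial on the units that are `1` modulo `s`. -/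
def IsPrim (s : R) (τ : Rˣ →* ℂˣ) : Prop := ∃ u : Rˣ, s ∣ (u : R) - 1 ∧ τ u ≠ 1

theorem exists_onePlus (hp : p * p = 0) (hps : p ∣ s) {u : Rˣ} (hu : s ∣ (u : R) - 1) :
    ∃ c y, s = p * c ∧ u = onePlus hp (Multiplicative.ofAdd (c * y)) := by
  obtain ⟨c, hc⟩ := hps
  obtain ⟨y, hy⟩ := hu
  refine ⟨c, y, hc, Units.ext ?_⟩
  change (u : R) = 1 + p * (c * y)
  rw [← mul_assoc, ← hc, ← hy]
  ring

/-- On `1 + pR ≅ R/pR` the character `τ` is additive, hence of the form `ψ(pt ·)`. If `t` were not a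
unit, `st = 0` would make `τ` trivial on `1 + sR`. -/
theorem Level.exists_param [Finite R] (L : Level f p s ψ) (hτ : IsPrim s τ) :
    ∃ t, f t ≠ 0 ∧ ∀ y, (τ (onePlus L.sq (Multiplicative.ofAdd y)) : ℂ) = ψ (p * (t * y)) := by
  let χ : AddChar R ℂ :=
    AddChar.toMonoidHomEquiv.symm ((Units.coeHom ℂ).comp (τ.comp (onePlus L.sq)))
  have hχ : ∀ y, χ y = τ (onePlus L.sq (Multiplicative.ofAdd y)) := fun y => rfl
  obtain ⟨t, ht⟩ := L.exists_psi_mul_mul χ fun y => by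
    have : onePlus L.sq (Multiplicative.ofAdd (p * y)) = 1 := by
      ext
      change 1 + p * (p * y) = 1
      linear_combination y * L.sq
    rw [hχ, this, map_one, Units.val_one]
  refine ⟨t, fun h0 => ?_, fun y => by rw [← hχ, ht]⟩
  obtain ⟨u, hu, h1⟩ := hτ
  obtain ⟨c, y, hc, rfl⟩ := exists_onePlus L.sq L.dvd hu
  refine h1 (Units.ext ?_)
  rw [← hχ, ht, Units.val_one, ← AddChar.map_zero_eq_one ψ]
  congr 1
  linear_combination y * L.socle t h0 - t * y * hc

theorem HasTheta.isEig (hp : p * p = 0) (hv : HasTheta hp τ ρ v) {t : R}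
    (ht : ∀ y, (τ (onePlus hp (Multiplicative.ofAdd y)) : ℂ) = ψ (p * (t * y))) :
    IsEig (slMat R) p ψ ρ !![t, 0; 0, 0] v := by
  intro γ B _ h2
  rw [slMat_apply] at h2
  have hγ : γ ∈ diagSubgroup p := by
    constructor
    · exact ⟨B 0 1, by rw [h2]; simp⟩
    · exact ⟨B 1 0, by rw [h2]; simp⟩
  have hu : diagUnit hp ⟨γ, hγ⟩ = onePlus hp (Multiplicative.ofAdd (B 0 0)) := by
    ext
    change γ 0 0 = 1 + p * B 0 0
    rw [h2]; simp
  rw [hv ⟨γ, hγ⟩, theta_apply, hu, ht]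
  congr 4
  rw [Matrix.trace_fin_two, Matrix.mul_apply, Matrix.mul_apply, Fin.sum_univ_two, Fin.sum_univ_two]
  simp

/-- The Weyl element. -/
def weyl (R : Type*) [CommRing R] : SL₂ R := ⟨!![0, 1; -1, 0], by simp [Matrix.det_fin_two]⟩

/-- Conjugation by the Weyl element exchanges `g₀₀` with `g₁₁ = g₀₀⁻¹`. -/
theorem HasTheta.weyl (hp : p * p = 0) (hv : HasTheta hp τ ρ v) :
    HasTheta hp τ⁻¹ ρ (ρ (weyl R) v) := by
  intro g
  have h1 : ((SLTwo.weyl R)⁻¹ * g.1 * SLTwo.weyl R : SL₂ R).1 = !![g.1 1 1, -g.1 1 0; -g.1 0 1, g.1 0 0] := by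
    change ((SLTwo.weyl R)⁻¹ : SL₂ R).1 * g.1.1 * !![0, 1; -1, 0] = _
    rw [Matrix.SpecialLinearGroup.SL2_inv_expl]
    change !![(0 : R), -1; - -1, 0] * g.1.1 * !![0, 1; -1, 0] = _
    rw [Matrix.eta_fin_two g.1.1]
    simp
  have h2 : (SLTwo.weyl R)⁻¹ * g.1 * SLTwo.weyl R ∈ diagSubgroup p := by
    rw [mem_diagSubgroup, h1]
    exact ⟨dvd_neg.2 g.2.2, dvd_neg.2 g.2.1⟩
  have h3 : diagUnit hp ⟨_, h2⟩ = (diagUnit hp g)⁻¹ := by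
    ext
    rw [diagUnit_val, h1]
    rfl
  have h4 : ρ g (ρ (SLTwo.weyl R) v) =
      ρ (SLTwo.weyl R) (ρ ((SLTwo.weyl R)⁻¹ * g.1 * SLTwo.weyl R) v) := by
    rw [← Module.End.mul_apply, ← Module.End.mul_apply, ← map_mul, ← map_mul]
    congr 2
    group
  rw [h4, hv ⟨_, h2⟩, map_smul, theta_apply, theta_apply, h3, map_inv, MonoidHom.inv_apply]

/-- The characters `τ` occurring in an irreducible representation form a single orbit under
inversion. -/
theorem Level.eq_or_eq_inv [Finite R] (L : Level f p s ψ) (hρ : ρ.IsIrreducible)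
    (hτ : IsPrim s τ) (hτ' : IsPrim s τ') (h0 : v ≠ 0) (h0' : v' ≠ 0)
    (hv : HasTheta L.sq τ ρ v) (hv' : HasTheta L.sq τ' ρ v') : τ' = τ ∨ τ' = τ⁻¹ := by
  obtain ⟨P, hP1, hP2, hP3⟩ := exists_projection ρ (diagSubgroup p) (theta L.sq τ')
  have key : ∀ (σ : Rˣ →* ℂˣ) (w : V), HasTheta L.sq σ ρ w → P w ≠ 0 → τ' = σ := by
    intro σ w hw hPw
    ext u
    have h1 := hP1 ⟨torus u, torus_mem u⟩ w
    rw [hw, map_smul] at h1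
    have h2 := smul_left_injective ℂ hPw h1
    have h3 : diagUnit L.sq ⟨torus u, torus_mem u⟩ = u := by ext; rfl
    rw [theta_apply, theta_apply, h3] at h2
    exact h2.symm
  obtain ⟨t, ht0, ht⟩ := L.exists_param hτ
  obtain ⟨t', ht0', ht'⟩ := L.exists_param hτ'
  -- If `P` killed every translate of `v` it would vanish on the irreducible `V`, although it
  -- multiplies `v'` by the order of the group.
  obtain ⟨g, hg⟩ : ∃ g, P (ρ g v) ≠ 0 := by
    by_contra! hg
    have h1 : (cyclicSub ρ v).toSubmodule ≤ LinearMap.ker P := by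
      refine Submodule.span_le.2 ?_
      rintro _ ⟨g, rfl⟩
      exact hg g
    rw [cyclicSub_eq_top ρ hρ h0] at h1
    have h2 : P v' = 0 := h1 (Submodule.mem_top : v' ∈ ⊤)
    rw [hP3 v' hv'] at h2
    exact (smul_ne_zero (Nat.cast_ne_zero.2 Nat.card_pos.ne') h0') h2
  have e1 := (hv.isEig L.sq ht).conj g
  have e2 : IsEig (slMat R) p ψ ρ !![t', 0; 0, 0] (P (ρ g v)) :=
    HasTheta.isEig L.sq (fun x => hP2 x _) ht'
  -- Congruence elements lie in the diagonal group, where composing `P` with them on either side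
  -- gives the same scalar multiple of `P`; so `P` keeps the eigenvector equation.
  have e3 : IsEig (slMat R) p ψ ρ (slMat R g * !![t, 0; 0, 0] * slMat R g⁻¹) (P (ρ g v)) := by
    intro γ B h1 h2
    have hγ : γ ∈ diagSubgroup p := by
      rw [slMat_apply] at h2
      constructor
      · exact ⟨B 0 1, by rw [h2]; simp⟩
      · exact ⟨B 1 0, by rw [h2]; simp⟩
    have h3 := congrArg P (e1 γ B h1 h2)
    rw [map_smul] at h3
    rw [← h3, hP1 ⟨γ, hγ⟩]
    exact hP2 ⟨γ, hγ⟩ _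
  have hE := IsEig.eqv L.sq L.nondegenerate slMat_surj hg e3 e2
  rcases L.mem_or_of_eqv (by rwa [map_zero]) (by rwa [map_zero]) hE with h | ⟨h, h', -⟩
  · left
    refine key τ v hv fun h1 => hg ?_
    rw [hv ⟨g, h⟩, map_smul, h1, smul_zero]
  · right
    refine key _ _ (hv.weyl L.sq) fun h1 => hg ?_
    have h2 : g * (SLTwo.weyl R)⁻¹ ∈ diagSubgroup p := by
      rw [mem_diagSubgroup]
      change p ∣ (g.1 * ((SLTwo.weyl R)⁻¹ : SL₂ R).1) 0 1 ∧ p ∣ (g.1 * ((SLTwo.weyl R)⁻¹ : SL₂ R).1) 1 0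
      rw [Matrix.SpecialLinearGroup.SL2_inv_expl]
      change p ∣ (g.1 * !![(0 : R), -1; - -1, 0]) 0 1 ∧ p ∣ (g.1 * !![(0 : R), -1; - -1, 0]) 1 0
      simpa [Matrix.mul_apply, Fin.sum_univ_two] using ⟨h, h'⟩
    have h3 := hv.weyl L.sq ⟨_, h2⟩
    rw [← Module.End.mul_apply, ← map_mul, inv_mul_cancel_right] at h3
    rw [h3, map_smul, h1, smul_zero]

/-- Self-inversion gives `ψ(2pty) = 1` for all `y`, so `2pt = 0` with `t` a unit and `p ∣ 2`. -/
theorem Level.ne_inv [Finite R] (L : Level f p s ψ) (hτ : IsPrim s τ) : τ ≠ τ⁻¹ := by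
  intro h
  obtain ⟨t, ht0, ht⟩ := L.exists_param hτ
  have h1 : p * (2 * t) = 0 := L.nondegenerate _ fun y => by
    have h2 := mul_eq_one_iff_eq_inv.2
      (DFunLike.congr_fun h (onePlus L.sq (Multiplicative.ofAdd y)))
    have h3 := congrArg Units.val h2
    rw [Units.val_mul, ht, ← AddChar.map_add_eq_mul, Units.val_one] at h3
    rw [← h3]
    congr 1
    ring
  apply L.two
  obtain ⟨u, hu⟩ := L.isUnit t ht0
  refine L.dvd_of_mul 2 ((u.mul_left_eq_zero).1 ?_)
  rw [hu]; linear_combination h1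

/-- The torus is commutative and preserves the eigenspace of a diagonal matrix; `τ` is its character
on a common eigenvector. -/
theorem Level.exists_hasTheta (L : Level f p s ψ) [FiniteDimensional ℂ V] {a b : R}
    (hab : f a ≠ f b) (hv : IsEig (slMat R) p ψ ρ !![a, 0; 0, b] v) (h0 : v ≠ 0) :
    ∃ τ, IsPrim s τ ∧ ∃ w, w ≠ 0 ∧ HasTheta L.sq τ ρ w := by
  set E := eigSpace (slMat R) p ψ ρ !![a, 0; 0, b] with hE
  obtain ⟨w, hwE, hw0, hw⟩ := exists_common_eigenvector_mem (fun u : Rˣ => ρ (torus u)) E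
    (fun h => h0 ((Submodule.mem_bot ℂ).1 (h ▸ hv : v ∈ (⊥ : Submodule ℂ V))))
    (fun u w hw => IsEig.stable L.sq hw (by
      change p • (!![(u : R), 0; 0, (u⁻¹ : Rˣ)] * _) = p • (_ * !![(u : R), 0; 0, (u⁻¹ : Rˣ)])
      simp [mul_comm]))
    (fun u u' w _ => by
      rw [← Module.End.mul_apply, ← Module.End.mul_apply, ← map_mul, ← map_mul, ← map_mul,
        ← map_mul, mul_comm])
  obtain ⟨χ, hχ⟩ := exists_character torus ρ hw0 hw
  refine ⟨χ.toHomUnits, ?_, w, hw0, ?_⟩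
  · obtain ⟨c, hc⟩ := L.dvd
    obtain ⟨z, hz⟩ := L.isUnit (a - b) (by rwa [map_sub, sub_ne_zero])
    -- Chosen so that `p(a - b)y = s`: then `τ(1 + py) = ψ(s) ≠ 1`.
    set y := c * ((z⁻¹ : Rˣ) : R) with hy
    refine ⟨onePlus L.sq (Multiplicative.ofAdd y), ⟨((z⁻¹ : Rˣ) : R), ?_⟩, fun h => ?_⟩
    · change 1 + p * y - 1 = _
      rw [hc, hy]; ring
    · have h1 : χ (onePlus L.sq (Multiplicative.ofAdd y)) = 1 := congrArg Units.val h
      have h2 := hwE (torus (onePlus L.sq (Multiplicative.ofAdd y))) !![y, 0; 0, -y]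
        (torus _).det_coe (by
          change !![1 + p * y, 0; 0, 1 - p * y] = _
          ext i j
          fin_cases i <;> fin_cases j <;> simp [sub_eq_add_neg])
      rw [hχ, h1] at h2
      have h3 := smul_left_injective ℂ hw0 h2
      apply L.psi_ne
      rw [h3]
      congr 1
      have hz' : (a - b) * ((z⁻¹ : Rˣ) : R) = 1 := by rw [← hz]; exact z.mul_inv
      simp [Matrix.trace_fin_two]
      rw [hy]
      linear_combination hc - p * c * hz'
  · intro g
    set u := diagUnit L.sq g with hu
    obtain ⟨x, hx⟩ := g.2.1
    obtain ⟨y, hy⟩ := g.2.2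
    -- Modulo its torus part, `g` is `1 + p` times a matrix with zero diagonal, where the character
    -- of a diagonal matrix is trivial.
    have h1 : ρ ((torus u)⁻¹ * g.1) w = w := by
      have h2 := hwE ((torus u)⁻¹ * g.1) !![0, ((u⁻¹ : Rˣ) : R) * x; u * y, 0]
        ((torus u)⁻¹ * g.1).det_coe (by
          rw [← map_inv]
          change !![((u⁻¹ : Rˣ) : R), 0; 0, ((u⁻¹⁻¹ : Rˣ) : R)] * g.1.1 = _
          have h4 : (u : R) * g.1 1 1 = 1 := u.mul_inv
          ext i j
          fin_cases i <;> fin_cases j <;> simp [Matrix.mul_apply, Fin.sum_univ_two]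
          · rfl
          · rw [hx]; ring
          · rw [hy]; ring
          · exact h4)
      rw [h2]
      simp [Matrix.trace_fin_two]
    have h5 : ρ g w = ρ (torus u) (ρ ((torus u)⁻¹ * g.1) w) := by
      rw [← Module.End.mul_apply, ← map_mul, mul_inv_cancel_left]
    rw [h5, h1, hχ]
    rfl

end Theta

/-! ### Which matrices occur, primitivity, and diagonalization -/

section Orbit

open Module

local notation "M₂" => Matrix (Fin 2) (Fin 2)
local notation "SL₂" => Matrix.SpecialLinearGroup (Fin 2)

variable {R k : Type*} [CommRing R] [Field k] {f : R →+* k} {p s : R} {ψ : AddChar R ℂ}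
  {V : Type*} [AddCommGroup V] [Module ℂ V] {ρ : Representation ℂ (SL₂ R) V} {v v' : V}
  {τ τ' : Rˣ →* ℂˣ}

theorem trace_mul_fin_two (A B : M₂ R) :
    (A * B).trace = A 0 0 * B 0 0 + A 0 1 * B 1 0 + (A 1 0 * B 0 1 + A 1 1 * B 1 1) := by
  rw [Matrix.trace_fin_two, Matrix.mul_apply, Matrix.mul_apply, Fin.sum_univ_two,
    Fin.sum_univ_two]

theorem Level.exists_isEig [Finite R] (L : Level f p s ψ) [FiniteDimensional ℂ V] [Nontrivial V] :
    ∃ A v, v ≠ 0 ∧ IsEig (slMat R) p ψ ρ A v := by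
  let K := {x : SL₂ R // ∃ B, slMat R x = 1 + p • B}
  have hcomm : ∀ x y : K, x.1 * y.1 = y.1 * x.1 := by
    rintro ⟨x, B, hB⟩ ⟨y, B', hB'⟩
    apply slMat_injective
    rw [map_mul, map_mul, hB, hB']
    simp only [add_mul, mul_add, Matrix.smul_mul, Matrix.mul_smul, smul_smul, L.sq, zero_smul,
      one_mul, mul_one]
    abel
  obtain ⟨v, h0, hv⟩ := exists_common_eigenvector (fun x : K => ρ x.1) fun x y v => by
    rw [← Module.End.mul_apply, ← Module.End.mul_apply, ← map_mul, ← map_mul, hcomm]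
  have key : ∀ φ : Multiplicative R →* SL₂ R, (∀ y, ∃ B, slMat R (φ y) = 1 + p • B) →
      (∀ y, φ (Multiplicative.ofAdd (p * y)) = 1) →
      ∃ t, ∀ y, ρ (φ (Multiplicative.ofAdd y)) v = ψ (p * (t * y)) • v := by
    intro φ hφ h1
    obtain ⟨χ, hχ⟩ := exists_character φ ρ h0 fun y => hv ⟨φ y, hφ y⟩
    obtain ⟨t, ht⟩ := L.exists_psi_mul_mul (AddChar.toMonoidHomEquiv.symm χ) fun y => by
      refine smul_left_injective ℂ h0 ?_
      change χ (Multiplicative.ofAdd (p * y)) • v = (1 : ℂ) • v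
      rw [← hχ, h1, map_one, Module.End.one_apply, one_smul]
    refine ⟨t, fun y => ?_⟩
    rw [hχ, ← ht]
    rfl
  have hpp : ∀ y : R, p * (p * y) = 0 := fun y => by rw [← mul_assoc, L.sq, zero_mul]
  obtain ⟨t₁, h₁⟩ := key (upper p) (fun y => ⟨!![0, y.toAdd; 0, 0], by
    change !![1, p * y.toAdd; 0, 1] = _
    ext i j; fin_cases i <;> fin_cases j <;> simp⟩) (fun y => by
    apply Subtype.ext
    change !![1, p * (p * y); 0, 1] = (1 : M₂ R)
    rw [hpp, Matrix.one_fin_two])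
  obtain ⟨t₂, h₂⟩ := key (lower p) (fun y => ⟨!![0, 0; y.toAdd, 0], by
    change !![1, 0; p * y.toAdd, 1] = _
    ext i j; fin_cases i <;> fin_cases j <;> simp⟩) (fun y => by
    apply Subtype.ext
    change !![1, 0; p * (p * y), 1] = (1 : M₂ R)
    rw [hpp, Matrix.one_fin_two])
  obtain ⟨t₃, h₃⟩ := key (torus.comp (onePlus L.sq)) (fun y => ⟨!![y.toAdd, 0; 0, -y.toAdd], by
    change !![1 + p * y.toAdd, 0; 0, 1 - p * y.toAdd] = _
    ext i j; fin_cases i <;> fin_cases j <;> simp [sub_eq_add_neg]⟩) (fun y => by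
    apply Subtype.ext
    change !![1 + p * (p * y), 0; 0, 1 - p * (p * y)] = (1 : M₂ R)
    rw [hpp, Matrix.one_fin_two, add_zero, sub_zero])
  -- The trace pairing transposes the off-diagonal entries. The last entry may be normalised to zero
  -- because only the class modulo scalars matters.
  refine ⟨!![t₃, t₂; t₁, 0], v, h0, fun γ B hdet hγ => ?_⟩
  have h0' := mul_trace_eq_zero_of_det L.sq (hγ ▸ hdet)
  rw [Matrix.trace_fin_two] at h0'
  have hprod : γ = upper p (Multiplicative.ofAdd (B 0 1)) * lower p (Multiplicative.ofAdd (B 1 0)) *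
      torus (onePlus L.sq (Multiplicative.ofAdd (B 0 0))) := by
    apply slMat_injective
    rw [hγ, map_mul, map_mul]
    change _ = !![1, p * B 0 1; 0, 1] * !![1, 0; p * B 1 0, 1] *
      !![1 + p * B 0 0, 0; 0, 1 - p * B 0 0]
    ext i j
    fin_cases i <;> fin_cases j <;> simp
    · linear_combination (-(B 0 1 * B 1 0) * (1 + p * B 0 0)) * L.sq
    · linear_combination (B 0 1 * B 0 0) * L.sq
    · linear_combination (-B 1 0 * B 0 0) * L.sq
    · linear_combination h0'
  rw [hprod, map_mul, map_mul, Module.End.mul_apply, Module.End.mul_apply]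
  have h₃' : ρ (torus (onePlus L.sq (Multiplicative.ofAdd (B 0 0)))) v = _ := h₃ (B 0 0)
  rw [h₃', map_smul, h₂, map_smul, map_smul, h₁, smul_smul, smul_smul, ← AddChar.map_add_eq_mul,
    ← AddChar.map_add_eq_mul, trace_mul_fin_two]
  congr 2
  simp
  ring

/-- A two by two matrix is not a scalar matrix. -/
def NonScalar (A : M₂ k) : Prop := A 0 1 ≠ 0 ∨ A 1 0 ≠ 0 ∨ A 0 0 ≠ A 1 1

/-- An irreducible representation nontrivial on the matrices `1 + s B` only involves characters
of non-scalar matrices. -/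
theorem Level.nonScalar (L : Level f p s ψ) (hρ : ρ.IsIrreducible) {A : M₂ R} (h0 : v ≠ 0)
    (hv : IsEig (slMat R) p ψ ρ A v) {γ : SL₂ R} {B : M₂ R} (hγ : slMat R γ = 1 + s • B)
    (h1 : ρ γ ≠ 1) : NonScalar (A.map f) := by
  by_contra hA
  simp only [NonScalar, not_or, not_not, Matrix.map_apply] at hA
  obtain ⟨hA1, hA2, hA3⟩ := hA
  have hs : s * s = 0 := L.socle s L.map_s
  obtain ⟨c, hc⟩ := L.dvd
  -- When `A` is scalar modulo the maximal ideal, `ψ_A` is trivial on the matrices `1 + sB`. Their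
  -- fixed space is stable under the whole group, so it is all of `V`.
  have hfix : IsEig (slMat R) s ψ ρ 0 v := by
    intro γ B hdet h
    have h2 := mul_trace_eq_zero_of_det hs (h ▸ hdet)
    have h3 : slMat R γ = 1 + p • (c • B) := by rw [h, hc, mul_smul]
    rw [hv γ _ hdet h3]
    congr 2
    rw [trace_mul_fin_two, zero_mul, Matrix.trace_zero]
    simp only [Matrix.smul_apply, smul_eq_mul]
    rw [Matrix.trace_fin_two] at h2
    have e1 := L.socle _ hA1
    have e2 := L.socle _ hA2
    have e3 := L.socle (A 0 0 - A 1 1) (by rw [map_sub, hA3, sub_self])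
    linear_combination -(A 0 0 * B 0 0 + A 0 1 * B 1 0 + A 1 0 * B 0 1 + A 1 1 * B 1 1) * hc +
      A 0 0 * h2 + B 1 0 * e1 + B 0 1 * e2 - B 1 1 * e3
  have htop := eq_top_of_stable ρ hρ (eigSpace (slMat R) s ψ ρ 0) (fun g w hw => by
    have := hw.conj g
    rwa [mul_zero, zero_mul] at this) hfix h0
  refine h1 (LinearMap.ext fun w => ?_)
  have hw : IsEig (slMat R) s ψ ρ 0 w := (htop.symm ▸ Submodule.mem_top : w ∈ eigSpace (slMat R) s ψ ρ 0)
  rw [hw γ B γ.det_coe hγ, zero_mul, Matrix.trace_zero, mul_zero, AddChar.map_zero_eq_one, one_smul,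
    Module.End.one_apply]

/-- A representation containing a primitive character `τ` is not a multiple of a one dimensional
character on the matrices `1 + s B`. -/
theorem Level.not_scalar_of_hasTheta [Finite R] (L : Level f p s ψ) (hτ : IsPrim s τ) (h0 : v ≠ 0)
    (hv : HasTheta L.sq τ ρ v) (χ : SL₂ R → ℂ)
    (h : ∀ γ B, slMat R γ = 1 + s • B → χ γ • ρ γ = 1) : False := by
  obtain ⟨t, ht0, ht⟩ := L.exists_param hτ
  obtain ⟨c, hc⟩ := L.dvd
  obtain ⟨z, hz⟩ := L.isUnit t ht0
  have e0 := hv.isEig L.sq ht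
  set g : SL₂ R := lower 1 (Multiplicative.ofAdd 1) with hg
  set y : R := ((z⁻¹ : Rˣ) : R) with hy
  have hzy : t * y = 1 := by rw [← hz]; exact z.mul_inv
  -- `γ` fixes `v`, which forces `χ γ = 1`, but it multiplies the translate of `v` by a lower
  -- unipotent by `ψ(s) ≠ 1`.
  set γ : SL₂ R := upper s (Multiplicative.ofAdd y) with hγ
  have h1 : slMat R γ = 1 + s • !![0, y; 0, 0] := by
    change !![1, s * y; 0, 1] = _
    ext i j; fin_cases i <;> fin_cases j <;> simp
  have h2 : slMat R γ = 1 + p • (c • !![0, y; 0, 0]) := by rw [h1, hc, mul_smul]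
  have h3 := e0 γ _ γ.det_coe h2
  rw [trace_mul_fin_two] at h3
  simp at h3
  have h4 := h γ _ h1
  have h5 : χ γ = 1 := by
    refine smul_left_injective ℂ h0 ?_
    have := LinearMap.congr_fun h4 v
    rw [LinearMap.smul_apply, h3] at this
    change χ γ • v = (1 : ℂ) • v
    rw [this, one_smul, Module.End.one_apply]
  rw [h5, one_smul] at h4
  have h6 : slMat R g * !![t, 0; 0, 0] * slMat R g⁻¹ = !![t, 0; t, 0] := by
    rw [slMat_apply, slMat_apply, Matrix.SpecialLinearGroup.SL2_inv_expl]
    change !![1, 0; 1 * 1, 1] * !![t, 0; 0, 0] * !![1, -0; -(1 * 1), 1] = _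
    simp
  have h7 := e0.conj g γ _ γ.det_coe h2
  rw [h6, h4, Module.End.one_apply, trace_mul_fin_two] at h7
  simp at h7
  have hgv : ρ g v ≠ 0 := fun hx => h0 (by
    have := congrArg (ρ g⁻¹) hx
    rwa [← Module.End.mul_apply, ← map_mul, inv_mul_cancel, map_one, map_zero] at this)
  have h8 : ρ g v = ψ s • ρ g v := by
    conv_lhs => rw [h7]
    congr 2
    linear_combination -hc + p * c * hzy
  refine L.psi_ne (smul_left_injective ℂ hgv ?_)
  change ψ s • ρ g v = (1 : ℂ) • ρ g v
  rw [← h8, one_smul]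

/-- Powers repeat in a finite ring: `x^m (1 - x^(n-m)) = 0`, and the second factor is a unit. -/
theorem Level.isNilpotent [Finite R] (L : Level f p s ψ) {x : R} (hx : f x = 0) :
    IsNilpotent x := by
  obtain ⟨m, n, hmn, h⟩ : ∃ m n, m < n ∧ x ^ m = x ^ n := by
    obtain ⟨m, n, hne, h⟩ := Finite.exists_ne_map_eq_of_infinite fun n : ℕ => x ^ n
    rcases lt_or_gt_of_ne hne with h1 | h1
    · exact ⟨m, n, h1, h⟩
    · exact ⟨n, m, h1, h.symm⟩
  refine ⟨m, ?_⟩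
  have hu : IsUnit (1 - x ^ (n - m)) := L.isUnit _ (by
    rw [map_sub, map_one, map_pow, hx, zero_pow (by omega), sub_zero]; exact one_ne_zero)
  refine (hu.mul_left_eq_zero).1 ?_
  rw [mul_sub, mul_one, ← pow_add, Nat.add_sub_cancel' hmn.le, h, sub_self]

/-- A matrix whose reduction has two distinct eigenvalues is conjugate to a diagonal matrix. -/
theorem Level.exists_conj_diag [Finite R] (L : Level f p s ψ) (A : M₂ R) {a b : k} (hab : a ≠ b)
    (htr : (A.map f).trace = a + b) (hdet : (A.map f).det = a * b) :
    ∃ (g : SL₂ R) (α β : R), f α ≠ f β ∧ slMat R g * A * slMat R g⁻¹ = !![α, 0; 0, β] := by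
  simp only [Matrix.trace_fin_two, Matrix.det_fin_two, Matrix.map_apply] at htr hdet
  obtain ⟨a₀, ha₀⟩ := L.surjective a
  -- Newton's method lifts the simple root `a` of the characteristic polynomial.
  obtain ⟨r, ⟨hr1, hr2⟩, -⟩ := Polynomial.existsUnique_nilpotent_sub_and_aeval_eq_zero
    (R := R) (S := R) (P := Polynomial.X ^ 2 - Polynomial.C (A 0 0 + A 1 1) * Polynomial.X +
      Polynomial.C (A 0 0 * A 1 1 - A 0 1 * A 1 0)) (x := a₀)
    (L.isNilpotent (by simp [ha₀, htr]; rw [hdet]; ring))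
    (L.isUnit _ (by
      simp [ha₀, htr]
      intro h; apply hab; linear_combination h))
  simp only [map_add, map_sub, map_mul, map_pow, Polynomial.aeval_X, Polynomial.aeval_C,
    Algebra.algebraMap_self, RingHom.id_apply] at hr2
  have hfr : f r = a := by
    have := (hr1.map f).eq_zero
    rw [map_sub, ha₀, sub_eq_zero] at this
    exact this.symm
  have key : ∀ α β : R, f α ≠ f β → α + β = A 0 0 + A 1 1 →
      α * β = A 0 0 * A 1 1 - A 0 1 * A 1 0 → f (A 0 0) ≠ f β →
      ∃ (g : SL₂ R) (α β : R), f α ≠ f β ∧ slMat R g * A * slMat R g⁻¹ = !![α, 0; 0, β] := by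
    intro α β h1 h2 h3 h4
    obtain ⟨δ, hδ⟩ := L.isUnit ((A 0 0 - β) * (β - α)) (by
      rw [map_mul, map_sub, map_sub]
      exact mul_ne_zero (sub_ne_zero.2 h4) (sub_ne_zero.2 h1.symm))
    set e := ((δ⁻¹ : Rˣ) : R)
    have he : (A 0 0 - β) * (β - α) * e = 1 := by rw [← hδ]; exact δ.mul_inv
    have hw : A 1 1 = α + β - A 0 0 := by linear_combination -h2
    -- The columns are eigenvectors for `α` and `β`; `e` rescales the first so that the determinant
    -- is one.
    let g : SL₂ R := ⟨!![e * (A 0 0 - β), A 0 1; e * A 1 0, β - A 0 0], by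
      rw [Matrix.det_fin_two_of]
      rw [hw] at h3
      linear_combination he - e * h3⟩
    have hg : A * slMat R g = slMat R g * !![α, 0; 0, β] := by
      rw [hw] at h3
      conv_lhs => rw [Matrix.eta_fin_two A]
      change _ * !![e * (A 0 0 - β), A 0 1; e * A 1 0, β - A 0 0] =
        !![e * (A 0 0 - β), A 0 1; e * A 1 0, β - A 0 0] * _
      rw [hw]
      ext i j
      fin_cases i <;> fin_cases j <;> simp
      · linear_combination e * h3
      · ring
      · ring
      · linear_combination h3
    refine ⟨g⁻¹, α, β, h1, ?_⟩
    rw [inv_inv, mul_assoc, hg, ← mul_assoc, map_inv_mul, one_mul]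
  have hr3 : f (A 0 0 + A 1 1 - r) = b := by
    rw [map_sub, map_add, htr, hfr]; ring
  -- These eigenvectors need `A₀₀ - β` to be a unit; exchanging the two roots achieves it in the
  -- remaining case.
  by_cases hx : f (A 0 0) = b
  · exact key (A 0 0 + A 1 1 - r) r (by rw [hr3, hfr]; exact hab.symm) (by ring)
      (by linear_combination -hr2) (by rw [hx, hfr]; exact hab.symm)
  · exact key r (A 0 0 + A 1 1 - r) (by rwa [hr3, hfr]) (by ring)
      (by linear_combination -hr2) (by rwa [hr3])

end Orbit

/-! ### The dimension bound through coinduction to `GL₂` -/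

section Bound

open Module

local notation "M₂" => Matrix (Fin 2) (Fin 2)
local notation "SL₂" => Matrix.SpecialLinearGroup (Fin 2)

variable {R k : Type*} [CommRing R] [Field k] {f : R →+* k} {p s : R} {ψ : AddChar R ℂ}
  {V : Type*} [AddCommGroup V] [Module ℂ V] {ρ : Representation ℂ (SL₂ R) V} {v v' : V}

/-- The centralizer of a matrix in `GL₂`. -/
def glCentralizer (A : M₂ R) : Subgroup (GL (Fin 2) R) where
  carrier := {h | h.1 * A = A * h.1}
  one_mem' := by simp
  mul_mem' {g h} hg hh := by
    change g.1 * h.1 * A = A * (g.1 * h.1)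
    rw [mul_assoc, (hh : h.1 * A = A * h.1), ← mul_assoc, (hg : g.1 * A = A * g.1), mul_assoc]
  inv_mem' {g} hg := by
    change (g⁻¹).1 * A = A * (g⁻¹).1
    have : (g⁻¹).1 * (g.1 * A) * (g⁻¹).1 = (g⁻¹).1 * (A * g.1) * (g⁻¹).1 := by
      rw [(hg : g.1 * A = A * g.1)]
    rw [← mul_assoc, ← Units.val_mul, inv_mul_cancel, Units.val_one, one_mul, mul_assoc, mul_assoc,
      ← Units.val_mul, mul_inv_cancel, Units.val_one, mul_one] at this
    exact this.symm

/-- A matrix commuting with a matrix of non-scalar reduction is a polynomial in it. -/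
theorem exists_eq_of_commute (hf : ∀ x, f x ≠ 0 → IsUnit x) {A M : M₂ R}
    (hA : NonScalar (A.map f)) (h : M * A = A * M) :
    ∃ a b : R, M = a • (1 : M₂ R) + b • A := by
  have h00 := congrFun (congrFun h 0) 0
  have h01 := congrFun (congrFun h 0) 1
  have h10 := congrFun (congrFun h 1) 0
  simp only [Matrix.mul_apply, Fin.sum_univ_two] at h00 h01 h10
  obtain hx | hx | hx := hA
  · obtain ⟨u, hu⟩ := hf _ hx
    have e : A 0 1 * ((u⁻¹ : Rˣ) : R) = 1 := by rw [← hu]; exact u.mul_inv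
    refine ⟨M 0 0 - ((u⁻¹ : Rˣ) : R) * M 0 1 * A 0 0, ((u⁻¹ : Rˣ) : R) * M 0 1, ?_⟩
    ext i j
    fin_cases i <;> fin_cases j <;> simp
    · linear_combination -M 0 1 * e
    · linear_combination -(M 1 0) * e - (u⁻¹ : Rˣ).1 * h00
    · linear_combination -(M 1 1 - M 0 0) * e - (u⁻¹ : Rˣ).1 * h01
  · obtain ⟨u, hu⟩ := hf _ hx
    have e : A 1 0 * ((u⁻¹ : Rˣ) : R) = 1 := by rw [← hu]; exact u.mul_inv
    refine ⟨M 0 0 - ((u⁻¹ : Rˣ) : R) * M 1 0 * A 0 0, ((u⁻¹ : Rˣ) : R) * M 1 0, ?_⟩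
    ext i j
    fin_cases i <;> fin_cases j <;> simp
    · linear_combination -(M 0 1) * e + (u⁻¹ : Rˣ).1 * h00
    · linear_combination -M 1 0 * e
    · linear_combination -(M 1 1 - M 0 0) * e + (u⁻¹ : Rˣ).1 * h10
  · obtain ⟨u, hu⟩ := hf (A 0 0 - A 1 1) (by rw [map_sub]; exact sub_ne_zero.2 hx)
    have e : (A 0 0 - A 1 1) * ((u⁻¹ : Rˣ) : R) = 1 := by rw [← hu]; exact u.mul_inv
    set d := (u⁻¹ : Rˣ).1
    refine ⟨M 0 0 - d * (M 0 0 - M 1 1) * A 0 0, d * (M 0 0 - M 1 1), ?_⟩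
    ext i j
    fin_cases i <;> fin_cases j <;> simp
    · linear_combination -(M 0 1) * e - d * h01
    · linear_combination -(M 1 0) * e + d * h10
    · linear_combination (M 0 0 - M 1 1) * e

/-- An irreducible representation over a character `A` with non-scalar reduction has dimension at
most the size of the orbit of `A` under `GL₂`. -/
theorem Level.finrank_le (L : Level f p s ψ) [Finite R] [FiniteDimensional ℂ V]
    (hρ : ρ.IsIrreducible) {A : M₂ R} (h0 : v ≠ 0) (hv : IsEig (slMat R) p ψ ρ A v)
    (hA : NonScalar (A.map f)) {R' : Type*} [CommRing R'] [Finite R'] (r : R →+* R')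
    (hr : Function.Surjective r) (hr0 : ∀ x, r x = 0 → p ∣ x) (f' : R' →+* k)
    (hf' : ∀ x, f' (r x) = f x) : finrank ℂ V ≤ (glCentralizer (A.map r)).index := by
  classical
  let ι : SL₂ R →* GL (Fin 2) R := Matrix.SpecialLinearGroup.toGL
  have hι : ∀ g, (ι g).1 = g.1 := fun g => rfl
  have hιi : Function.Injective ι := fun g h hgh => Subtype.ext (congrArg Units.val hgh)
  let S := (glCentralizer (A.map r)).comap (Matrix.GeneralLinearGroup.map (n := Fin 2) r)
  have hSi : S.index ≤ (glCentralizer (A.map r)).index := by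
    rw [Subgroup.index_comap, ← Subgroup.relIndex_top_right]
    refine Subgroup.relIndex_le_of_le_right le_top ?_
    rw [Subgroup.relIndex_top_right]
    exact Subgroup.index_ne_zero_of_finite
  refine le_trans ?_ hSi
  set μ : GL (Fin 2) R →* M₂ R := Units.coeHom (M₂ R) with hμ
  set σ := Representation.coind ι ρ with hσ
  -- The function `g ↦ ρ(g)v` on `SL₂`, extended by zero, is an eigenvector for the same `A` in the
  -- coinduced representation.
  let F : GL (Fin 2) R → V := fun x => if h : ∃ g, ι g = x then ρ h.choose v else 0
  have hFι : ∀ g, F (ι g) = ρ g v := by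
    intro g
    have h : ∃ g', ι g' = ι g := ⟨g, rfl⟩
    simp only [F]
    rw [dif_pos h, hιi h.choose_spec]
  have hF0 : ∀ x, (¬ ∃ g, ι g = x) → F x = 0 := fun x hx => dif_neg hx
  have hFW : F ∈ Representation.coindV ι ρ := by
    intro g x
    by_cases hx : ∃ g, ι g = x
    · obtain ⟨g', rfl⟩ := hx
      rw [← map_mul, hFι, hFι, map_mul, Module.End.mul_apply]
    · rw [hF0 _ hx, hF0, map_zero]
      rintro ⟨g', hg'⟩
      exact hx ⟨g⁻¹ * g', by rw [map_mul, hg', map_inv, inv_mul_cancel_left]⟩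
  let F' : Representation.coindV ι ρ := ⟨F, hFW⟩
  have hF'0 : F' ≠ 0 := by
    intro h
    have h1 : F (ι 1) = 0 := congrFun (congrArg Subtype.val h) _
    rw [hFι, map_one] at h1
    exact h0 h1
  have hF' : IsEig μ p ψ σ A F' := by
    intro γ B h1 h2
    obtain ⟨γ, rfl⟩ : ∃ γ', ι γ' = γ := ⟨⟨γ.1, h1⟩, Units.ext rfl⟩
    refine Subtype.ext (funext fun x => ?_)
    change F (x * ι γ) = ψ (p * (A * B).trace) • F x
    by_cases hx : ∃ g, ι g = x
    · obtain ⟨g, rfl⟩ := hx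
      rw [← map_mul, hFι, hFι, map_mul, Module.End.mul_apply, hv _ B h1 h2, map_smul]
    · rw [hF0 _ hx, hF0, smul_zero]
      rintro ⟨g', hg'⟩
      exact hx ⟨g' * γ⁻¹, by rw [map_mul, hg', map_inv, mul_inv_cancel_right]⟩
  -- Modulo `p` the centralizer consists of polynomials in `A`; this is the shape that
  -- `IsEig.commute` requires.
  have hform : ∀ h ∈ S, ∃ (a b : R) (X : M₂ R), μ h = a • (1 : M₂ R) + b • A + p • X := by
    intro h hh
    have h1 : (h.1.map r) * (A.map r) = (A.map r) * (h.1.map r) := hh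
    have hfu : ∀ x, f' x ≠ 0 → IsUnit x := by
      intro x hx
      obtain ⟨y, rfl⟩ := hr x
      exact (L.isUnit y (by rwa [hf'] at hx)).map r
    have hA' : NonScalar ((A.map r).map f') := by
      have : (A.map r).map f' = A.map f := by ext i j; simp [hf']
      rwa [this]
    obtain ⟨a', b', hab⟩ := exists_eq_of_commute hfu hA' h1
    obtain ⟨a, rfl⟩ := hr a'
    obtain ⟨b, rfl⟩ := hr b'
    have h2 : ∀ i j, ∃ x, (h.1 - (a • (1 : M₂ R) + b • A)) i j = p * x := by
      intro i j
      refine hr0 _ ?_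
      have h3 := congrFun (congrFun hab i) j
      simp only [Matrix.map_apply, Matrix.add_apply, Matrix.smul_apply, smul_eq_mul] at h3
      simp only [Matrix.sub_apply, Matrix.add_apply, Matrix.smul_apply, smul_eq_mul, map_sub,
        map_add, map_mul, h3]
      rw [Matrix.one_apply, Matrix.one_apply]
      split_ifs <;> simp
    choose X hX using h2
    refine ⟨a, b, Matrix.of X, ?_⟩
    rw [← sub_eq_iff_eq_add']
    ext i j
    exact hX i j
  have hcomm : ∀ h ∈ S, p • (μ h * A) = p • (A * μ h) := by
    intro h hh
    obtain ⟨a, b, X, hX⟩ := hform h hh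
    rw [hX]
    simp only [add_mul, mul_add, smul_add, Matrix.smul_mul, Matrix.mul_smul, smul_smul, L.sq,
      zero_smul, one_mul, mul_one]
  obtain ⟨w, hw, hw0, hwS⟩ := exists_common_eigenvector_mem (fun h : S => σ h.1)
    (eigSpace μ p ψ σ A)
    (fun h => hF'0 ((Submodule.mem_bot ℂ).1 (h ▸ hF' : F' ∈ (⊥ : Submodule ℂ _))))
    (fun h w hw => IsEig.stable L.sq hw (hcomm h h.2))
    (fun g h w hw => by
      obtain ⟨a, b, X, hX⟩ := hform g g.2
      obtain ⟨a', b', Y, hY⟩ := hform h h.2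
      exact IsEig.commute L.sq hw hX hY)
  exact finrank_le_index_of_coind ι ρ hρ hw0 S fun h hh => hwS ⟨h, hh⟩

end Bound

/-! ### Orders of groups, centralizers and character groups -/

section Counting

local notation "M₂" => Matrix (Fin 2) (Fin 2)
local notation "SL₂" => Matrix.SpecialLinearGroup (Fin 2)

theorem card_preimage_mul {M N : Type*} [AddGroup M] [AddGroup N] [Finite M] (φ : M →+ N)
    (hφ : Function.Surjective φ) (Y : Set N) :
    Nat.card {x // φ x ∈ Y} * Nat.card N = Nat.card Y * Nat.card M := by
  choose g hg using hφ
  have e : ∀ Z : Set N, {x // φ x ∈ Z} ≃ Z × φ.ker := fun Z =>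
    { toFun := fun x => (⟨φ x, x.2⟩, ⟨-g (φ x) + x, by
        rw [AddMonoidHom.mem_ker, map_add, map_neg, hg, neg_add_cancel]⟩)
      invFun := fun y => ⟨g y.1 + y.2, by
        rw [map_add, hg, AddMonoidHom.mem_ker.1 y.2.2, add_zero]; exact y.1.2⟩
      left_inv := fun x => by simp
      right_inv := fun y => by
        have : φ (g y.1 + y.2) = y.1 := by
          rw [map_add, hg, AddMonoidHom.mem_ker.1 y.2.2, add_zero]
        ext <;> simp [this] }
  have h1 := Nat.card_congr (e Y)
  have h2 := Nat.card_congr ((Equiv.subtypeUnivEquiv (p := fun x => φ x ∈ Set.univ)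
    fun x => Set.mem_univ _).symm.trans (e Set.univ))
  rw [Nat.card_prod, Nat.card_univ] at h2
  rw [h1, h2, Nat.card_prod]
  ring

variable {R k : Type*} [CommRing R] [Field k] (f : R →+* k)

theorem card_units_mul [Finite R] (hs : Function.Surjective f) (hf : ∀ x, f x ≠ 0 → IsUnit x) :
    Nat.card Rˣ * Nat.card k = (Nat.card k - 1) * Nat.card R := by
  have : Finite k := Finite.of_surjective f hs
  have e : Rˣ ≃ {x // f.toAddMonoidHom x ∈ ({0}ᶜ : Set k)} :=
    { toFun := fun u => ⟨u, (u.isUnit.map f).ne_zero⟩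
      invFun := fun x => (hf x x.2).unit
      left_inv := fun u => by ext; rfl
      right_inv := fun x => rfl }
  rw [Nat.card_congr e, card_preimage_mul f.toAddMonoidHom hs, Nat.card_coe_set_eq,
    Set.ncard_compl, Set.ncard_singleton]

/-- Invertible matrices are those with invertible reduction. -/
def glEquiv (hf : ∀ x, f x ≠ 0 → IsUnit x) :
    GL (Fin 2) R ≃ {M : M₂ R // f.toAddMonoidHom.mapMatrix M ∈ {N : M₂ k | N.det ≠ 0}} where
  toFun h := ⟨h.1, by
    have : IsUnit (f h.1.det) := ((Matrix.isUnit_iff_isUnit_det _).1 h.isUnit).map f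
    rw [RingHom.map_det] at this
    exact this.ne_zero⟩
  invFun M := Matrix.GeneralLinearGroup.mk'' M.1 (hf _ (by
    rw [RingHom.map_det]; exact M.2))
  left_inv h := by ext; rfl
  right_inv M := rfl

theorem mapMatrix_surjective (hs : Function.Surjective f) :
    Function.Surjective (f.toAddMonoidHom.mapMatrix (m := Fin 2) (n := Fin 2)) := by
  intro N
  choose g hg using hs
  exact ⟨N.map g, by ext i j; exact hg _⟩

theorem card_matrix (R : Type*) [Finite R] : Nat.card (M₂ R) = Nat.card R ^ 4 := by
  rw [Matrix, Nat.card_fun, Nat.card_fun, ← pow_mul]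
  simp

theorem card_gl_mul [Finite R] [Finite k] (hs : Function.Surjective f) (hf : ∀ x, f x ≠ 0 → IsUnit x) :
    Nat.card (GL (Fin 2) R) * Nat.card k ^ 4 =
      (Nat.card k ^ 2 - 1) * (Nat.card k ^ 2 - Nat.card k) * Nat.card R ^ 4 := by
  classical
  have : Fintype k := Fintype.ofFinite k
  have h1 := card_preimage_mul (f.toAddMonoidHom.mapMatrix (m := Fin 2) (n := Fin 2))
    (mapMatrix_surjective f hs) {N | N.det ≠ 0}
  rw [← Nat.card_congr (glEquiv f hf), card_matrix, card_matrix] at h1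
  rw [h1]
  congr 1
  have e : GL (Fin 2) k ≃ ({N | N.det ≠ 0} : Set (M₂ k)) :=
    { toFun := fun h => ⟨h.1, ((Matrix.isUnit_iff_isUnit_det _).1 h.isUnit).ne_zero⟩
      invFun := fun M => Matrix.GeneralLinearGroup.mk'' M.1 (isUnit_iff_ne_zero.2 M.2)
      left_inv := fun h => by ext; rfl
      right_inv := fun M => rfl }
  rw [← Nat.card_congr e, Matrix.card_GL_field, Fin.prod_univ_two, Nat.card_eq_fintype_card]
  simp

/-- The zero set of a form without two distinct rational zeros is small. -/
theorem card_sub_le_card_units_of_nonsplit [Finite k] (A : M₂ k)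
    (hns : ¬ ∃ a b, a ≠ b ∧ A.trace = a + b ∧ A.det = a * b) :
    Nat.card k ^ 2 - Nat.card k ≤
      Nat.card {x : k × k | (x.1 • (1 : M₂ k) + x.2 • A).det ≠ 0} := by
  have hdet : ∀ x y : k, (x • (1 : M₂ k) + y • A).det = x ^ 2 + x * y * A.trace + y ^ 2 * A.det := by
    intro x y
    rw [Matrix.det_fin_two, Matrix.det_fin_two, Matrix.trace_fin_two]
    simp
    ring
  set Z := {x : k × k | (x.1 • (1 : M₂ k) + x.2 • A).det = 0} with hZ
  have h1 : {x : k × k | (x.1 • (1 : M₂ k) + x.2 • A).det ≠ 0} = Zᶜ := rfl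
  -- For each `y` there is at most one zero `x`: distinct zeros `x`, `x'` would give distinct
  -- eigenvalues `-x/y`, `-x'/y`.
  have h2 : Z.ncard ≤ Nat.card k := by
    rw [← Set.ncard_univ]
    refine Set.ncard_le_ncard_of_injOn Prod.snd (fun _ _ => Set.mem_univ _) ?_
    rintro ⟨x, y⟩ hx ⟨x', y'⟩ hx' (rfl : y = y')
    have e : x ^ 2 + x * y * A.trace + y ^ 2 * A.det = 0 := (hdet _ _).symm.trans hx
    have e' : x' ^ 2 + x' * y * A.trace + y ^ 2 * A.det = 0 := (hdet _ _).symm.trans hx'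
    by_contra hne
    have hxx : x ≠ x' := fun h => hne (by rw [h])
    have hy : y ≠ 0 := by
      rintro rfl
      apply hxx
      simp at e e'
      rw [e, e']
    have e3 : x + x' + y * A.trace = 0 := by
      refine (mul_eq_zero.1 ?_).resolve_left (sub_ne_zero.2 hxx)
      linear_combination e - e'
    refine hns ⟨-x / y, -x' / y, ?_, ?_, ?_⟩
    · intro h
      field_simp at h
      exact hxx (neg_injective h)
    · field_simp
      linear_combination e3
    · field_simp
      linear_combination e - x * e3
  rw [h1, Nat.card_coe_set_eq, Set.ncard_compl, Nat.card_prod, ← sq]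
  omega

/-- Pairs `(a, b)` with `a + bA` invertible inject into the centralizer, since `A` is not scalar
modulo the maximal ideal; invertibility is tested over the residue field. -/
theorem card_centralizer_ge [Finite R] [Finite k] (hs : Function.Surjective f)
    (hf : ∀ x, f x ≠ 0 → IsUnit x) (A : M₂ R) (hA : NonScalar (A.map f))
    (hns : ¬ ∃ a b, a ≠ b ∧ (A.map f).trace = a + b ∧ (A.map f).det = a * b) :
    (Nat.card k ^ 2 - Nat.card k) * Nat.card R ^ 2 ≤
      Nat.card (glCentralizer A) * Nat.card k ^ 2 := by
  have h1 := card_preimage_mul (f.toAddMonoidHom.prodMap f.toAddMonoidHom)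
    (hs.prodMap hs) {x : k × k | (x.1 • (1 : M₂ k) + x.2 • A.map f).det ≠ 0}
  rw [Nat.card_prod, Nat.card_prod, ← sq, ← sq] at h1
  refine le_trans (Nat.mul_le_mul_right _ (card_sub_le_card_units_of_nonsplit _ hns)) ?_
  rw [← h1]
  refine Nat.mul_le_mul_right _ ?_
  have hu : ∀ x : R × R, ((f x.1) • (1 : M₂ k) + (f x.2) • A.map f).det ≠ 0 →
      IsUnit (x.1 • (1 : M₂ R) + x.2 • A).det := by
    intro x hx
    refine hf _ ?_
    rw [RingHom.map_det]
    convert hx using 2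
    ext i j
    simp [Matrix.one_apply, apply_ite f]
  refine Nat.card_le_card_of_injective (fun x => ⟨Matrix.GeneralLinearGroup.mk'' _ (hu x.1 x.2), ?_⟩) ?_
  · change (x.1.1 • (1 : M₂ R) + x.1.2 • A) * A = A * (x.1.1 • (1 : M₂ R) + x.1.2 • A)
    simp only [add_mul, mul_add, Matrix.smul_mul, Matrix.mul_smul, one_mul, mul_one]
  · rintro ⟨⟨a, b⟩, hx⟩ ⟨⟨a', b'⟩, hx'⟩ h
    have h2 : a • (1 : M₂ R) + b • A = a' • (1 : M₂ R) + b' • A :=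
      congrArg (fun y : glCentralizer A => y.1.1) h
    have h00 := congrFun (congrFun h2 0) 0
    have h01 := congrFun (congrFun h2 0) 1
    have h10 := congrFun (congrFun h2 1) 0
    have h11 := congrFun (congrFun h2 1) 1
    simp at h00 h01 h10 h11
    have hb : b = b' := by
      rw [← sub_eq_zero]
      obtain h3 | h3 | h3 := hA
      · exact ((hf _ h3).mul_left_eq_zero).1 (by linear_combination h01)
      · exact ((hf _ h3).mul_left_eq_zero).1 (by linear_combination h10)
      · refine ((hf (A 0 0 - A 1 1) ?_).mul_left_eq_zero).1 (by linear_combination h00 - h11)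
        rw [map_sub]; exact sub_ne_zero.2 h3
    subst hb
    simp at h00
    simp [h00]

theorem index_centralizer_le [Finite R] [Finite k] (hs : Function.Surjective f)
    (hf : ∀ x, f x ≠ 0 → IsUnit x) (A : M₂ R) (hA : NonScalar (A.map f))
    (hns : ¬ ∃ a b, a ≠ b ∧ (A.map f).trace = a + b ∧ (A.map f).det = a * b) {l : ℕ}
    (hR : Nat.card R = Nat.card k ^ l) :
    (glCentralizer A).index * Nat.card k ^ 2 ≤ (Nat.card k ^ 2 - 1) * Nat.card k ^ (2 * l) := by
  have h1 := card_centralizer_ge f hs hf A hA hns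
  have h2 := card_gl_mul f hs hf
  have h3 := (glCentralizer A).card_mul_index
  rw [hR, ← pow_mul] at h1 h2
  set q := Nat.card k
  have hq : 1 < q := Finite.one_lt_card
  have hpos : 0 < (q ^ 2 - q) * q ^ (l * 2) := by
    refine Nat.mul_pos (Nat.sub_pos_of_lt ?_) (by positivity)
    nlinarith
  refine Nat.le_of_mul_le_mul_right ?_ hpos
  calc (glCentralizer A).index * q ^ 2 * ((q ^ 2 - q) * q ^ (l * 2))
      ≤ (glCentralizer A).index * q ^ 2 * (Nat.card (glCentralizer A) * q ^ 2) :=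
        Nat.mul_le_mul_left _ h1
    _ = Nat.card (GL (Fin 2) R) * q ^ 4 := by rw [← h3]; ring
    _ = _ := by rw [h2]; ring

theorem card_gl_eq : Nat.card (GL (Fin 2) R) = Nat.card (SL₂ R) * Nat.card Rˣ := by
  have h := (Matrix.GeneralLinearGroup.det (n := Fin 2) (R := R)).ker.card_mul_index
  rw [Subgroup.index_ker, MonoidHom.range_eq_top.2, Subgroup.card_top] at h
  · rw [← h]
    congr 1
    refine Nat.card_congr
      { toFun := fun g => ⟨g.1.1, congrArg Units.val g.2⟩
        invFun := fun g => ⟨Matrix.SpecialLinearGroup.toGL g, Units.ext g.2⟩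
        left_inv := fun g => by ext; rfl
        right_inv := fun g => rfl }
  · intro u
    refine ⟨Matrix.GeneralLinearGroup.mk'' !![(u : R), 0; 0, 1] (by simp), Units.ext ?_⟩
    change (!![(u : R), 0; 0, 1] : M₂ R).det = u
    simp

/-- An element is determined by `g₀₀` and the off-diagonal entries, because `g₁₁ = g₀₀⁻¹`. -/
theorem card_diagSubgroup {p : R} (hp : p * p = 0) :
    Nat.card (diagSubgroup p) = Nat.card Rˣ * Nat.card {x // p ∣ x} ^ 2 := by
  have hz : ∀ x y : {x // p ∣ x}, (x : R) * y = 0 := by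
    rintro ⟨_, x, rfl⟩ ⟨_, y, rfl⟩
    linear_combination x * y * hp
  have e : diagSubgroup p ≃ Rˣ × ({x // p ∣ x} × {x // p ∣ x}) :=
    { toFun := fun g => (diagUnit hp g, ⟨g.1 0 1, g.2.1⟩, ⟨g.1 1 0, g.2.2⟩)
      invFun := fun x => ⟨⟨!![(x.1 : R), x.2.1; x.2.2, ((x.1⁻¹ : Rˣ) : R)], by
        simp [Matrix.det_fin_two, hz]⟩, x.2.1.2, x.2.2.2⟩
      left_inv := fun g => by
        apply Subtype.ext
        apply Subtype.ext
        change !![g.1 0 0, g.1 0 1; g.1 1 0, g.1 1 1] = _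
        exact (Matrix.eta_fin_two _).symm
      right_inv := fun x => by
        refine Prod.ext (Units.ext rfl) rfl }
  rw [Nat.card_congr e, Nat.card_prod, Nat.card_prod, sq]

theorem index_diagSubgroup [Finite R] [Finite k] (hs : Function.Surjective f) (hf : ∀ x, f x ≠ 0 → IsUnit x)
    {p : R} (hp : p * p = 0) {l : ℕ} (hl : 1 ≤ l) (hR : Nat.card R = Nat.card k ^ (2 * l))
    (hpl : Nat.card {x // p ∣ x} = Nat.card k ^ l) :
    (diagSubgroup p).index = (Nat.card k + 1) * Nat.card k ^ (2 * l - 1) := by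
  have h1 := card_gl_mul f hs hf
  have h2 := card_units_mul f hs hf
  have h3 := (diagSubgroup p).card_mul_index
  rw [card_diagSubgroup hp, hpl] at h3
  rw [card_gl_eq, ← h3, hR] at h1
  rw [hR] at h2
  set q := Nat.card k
  set D := (diagSubgroup p).index
  set u := Nat.card Rˣ
  obtain ⟨m, rfl⟩ := Nat.exists_eq_add_of_le' hl
  have hq : 1 < q := Finite.one_lt_card
  obtain ⟨r, hr⟩ := Nat.exists_eq_add_of_le' hq.le
  have e1 : q - 1 = r := by omega
  have e2 : q ^ 2 - 1 = r * (q + 1) := by rw [hr]; apply Nat.sub_eq_of_eq_add; ring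
  have e3 : q ^ 2 - q = r * q := by rw [hr]; apply Nat.sub_eq_of_eq_add; ring
  rw [e1] at h2
  rw [e2, e3] at h1
  have hr0 : 0 < r := by omega
  have e4 : 2 * (m + 1) - 1 = 2 * m + 1 := by omega
  rw [e4]
  have hpos : 0 < r ^ 2 * q ^ (6 * m + 8) := by positivity
  refine Nat.eq_of_mul_eq_mul_right hpos ?_
  calc D * (r ^ 2 * q ^ (6 * m + 8)) = D * (r * q ^ (2 * (m + 1))) ^ 2 * q ^ (2 * (m + 1)) * q ^ 2 := by ring
    _ = u * (q ^ (m + 1)) ^ 2 * D * u * q ^ 4 := by rw [← h2]; ring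
    _ = _ := by rw [h1]; ring

/-- The subgroup of units that are `1` modulo `s`. -/
def unitSubgroup (s : R) : Subgroup Rˣ where
  carrier := {u | s ∣ (u : R) - 1}
  one_mem' := by simp
  mul_mem' {u v} hu hv := by
    change s ∣ (u : R) * v - 1
    have : (u : R) * v - 1 = u * (v - 1) + (u - 1) := by ring
    rw [this]
    exact dvd_add (hv.mul_left _) hu
  inv_mem' {u} hu := by
    change s ∣ ((u⁻¹ : Rˣ) : R) - 1
    have : ((u⁻¹ : Rˣ) : R) - 1 = -((u⁻¹ : Rˣ) : R) * (u - 1) := by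
      have := u.inv_mul
      linear_combination this
    rw [this]
    exact hu.mul_left _

/-- The element `1 + sy` depends only on the residue of `y`, and `s ≠ 0` makes different residues
give different units. -/
theorem Level.card_unitSubgroup {f : R →+* k} {p s : R} {ψ : AddChar R ℂ}
    (L : Level f p s ψ) : Nat.card (unitSubgroup s) = Nat.card k := by
  choose g hg using L.surjective
  have hu : ∀ y : k, IsUnit (1 + s * g y) := fun y => L.isUnit _ (by
    rw [map_add, map_mul, L.map_s, map_one, zero_mul, add_zero]; exact one_ne_zero)
  refine (Nat.card_congr (Equiv.ofBijective
    (fun y : k => (⟨(hu y).unit, ⟨g y, add_sub_cancel_left _ _⟩⟩ : unitSubgroup s)) ⟨?_, ?_⟩)).symm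
  · intro y y' h
    have h1 : 1 + s * g y = 1 + s * g y' := congrArg (fun u : unitSubgroup s => (u.1 : R)) h
    rw [← hg y, ← hg y', ← sub_eq_zero, ← map_sub]
    by_contra hne
    have h2 : s = 0 := ((L.isUnit _ hne).mul_left_eq_zero).1 (by linear_combination h1)
    exact L.psi_ne (by rw [h2, AddChar.map_zero_eq_one])
  · rintro ⟨u, y, hy⟩
    refine ⟨f y, Subtype.ext (Units.ext ?_)⟩
    change 1 + s * g (f y) = u
    have := L.socle (g (f y) - y) (by rw [map_sub, hg, sub_self])
    linear_combination this - hy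

/-- The imprimitive characters are those trivial on a subgroup of order `q`, so they form a fraction
`1/q` of all characters of `Rˣ`. -/
theorem Level.card_isPrim [Finite R] {f : R →+* k} {p s : R} {ψ : AddChar R ℂ} (L : Level f p s ψ) {l : ℕ}
    (hl : 1 ≤ l) (hR : Nat.card R = Nat.card k ^ (2 * l)) :
    Nat.card {τ : Rˣ →* ℂˣ // IsPrim s τ} = (Nat.card k - 1) ^ 2 * Nat.card k ^ (2 * l - 2) := by
  classical
  have : Finite k := Finite.of_surjective f L.surjective
  set D := MonoidHom.domRestrictHom (unitSubgroup s) ℂˣ with hD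
  have hker : ∀ τ : Rˣ →* ℂˣ, ¬ IsPrim s τ ↔ τ ∈ D.ker := by
    intro τ
    rw [MonoidHom.mem_ker, IsPrim]
    push Not
    exact ⟨fun h => MonoidHom.ext fun u => h u.1 u.2, fun h u hu => DFunLike.congr_fun h ⟨u, hu⟩⟩
  have : Finite (Rˣ →* ℂˣ) := Nat.finite_of_card_ne_zero (by
    rw [CommGroup.card_monoidHom_of_hasEnoughRootsOfUnity]
    exact Nat.card_pos.ne')
  have h1 : Nat.card {τ : Rˣ →* ℂˣ // IsPrim s τ} + Nat.card D.ker = Nat.card Rˣ := by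
    rw [← CommGroup.card_monoidHom_of_hasEnoughRootsOfUnity Rˣ ℂ,
      ← Nat.card_congr (Equiv.sumCompl (IsPrim s)), Nat.card_sum]
    congr 1
    exact Nat.card_congr (Equiv.subtypeEquivRight fun τ => (hker τ).symm)
  have h2 : Nat.card D.ker * Nat.card k = Nat.card Rˣ := by
    rw [CommGroup.card_domRestrictHom_ker, ← L.card_unitSubgroup]
    exact (Subgroup.card_eq_card_quotient_mul_card_subgroup _).symm
  have h3 := card_units_mul f L.surjective L.isUnit
  rw [hR] at h3
  set q := Nat.card k
  have hq : 1 < q := Finite.one_lt_card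
  obtain ⟨r, hr⟩ := Nat.exists_eq_add_of_le' hq.le
  obtain ⟨m, rfl⟩ := Nat.exists_eq_add_of_le' hl
  have e1 : q - 1 = r := by omega
  have e2 : 2 * (m + 1) - 2 = 2 * m := by omega
  rw [e1] at h3 ⊢
  rw [e2]
  set N := Nat.card {τ : Rˣ →* ℂˣ // IsPrim s τ}
  set K := Nat.card D.ker
  have h4 : K = r * q ^ (2 * m) := by
    refine Nat.eq_of_mul_eq_mul_right (show 0 < q ^ 2 by positivity) ?_
    calc K * q ^ 2 = Nat.card Rˣ * q := by rw [← h2]; ring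
      _ = _ := by rw [h3]; ring
  have h5 : N + K = K * (r + 1) := by rw [h1, ← h2, hr]
  rw [h4] at h5
  have h6 : N + r * q ^ (2 * m) = r ^ 2 * q ^ (2 * m) + r * q ^ (2 * m) := by rw [h5]; ring
  exact Nat.add_right_cancel h6

end Counting

/-! ### Split versus nonsplit dimensions -/

section Dimension

open Module

local notation "M₂" => Matrix (Fin 2) (Fin 2)
local notation "SL₂" => Matrix.SpecialLinearGroup (Fin 2)

/-- With a double eigenvalue `a`, `A - a` would be nilpotent and semisimple, hence zero, and `A`
would be scalar. Conversely, distinct roots make the characteristic polynomial squarefree. -/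
theorem isSplitSemisimple_iff {k : Type*} [Field k] {A : M₂ k} (hA : NonScalar A) :
    IsSplitSemisimple A ↔ ∃ a b, a ≠ b ∧ A.trace = a + b ∧ A.det = a * b := by
  constructor
  · rintro ⟨h1, h2⟩
    obtain ⟨a, ha⟩ := h1.exists_eval_eq_zero (by
      rw [Matrix.charpoly_degree_eq_dim]; simp)
    rw [Matrix.charpoly_fin_two] at ha
    simp at ha
    have hdet : A.det = a * (A.trace - a) := by linear_combination ha
    refine ⟨a, A.trace - a, fun hab => ?_, by ring, hdet⟩
    have hsq : (A - algebraMap k (M₂ k) a) ^ 2 = 0 := by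
      have h3 := Matrix.aeval_self_charpoly A
      rw [Matrix.charpoly_fin_two] at h3
      simp at h3
      rw [hdet, ← hab, show A.trace = a + a by linear_combination -hab] at h3
      rw [← h3]
      simp only [map_add, map_mul]
      have hc := Algebra.commutes a A
      rw [sq, sq, sub_mul, mul_sub, mul_sub, add_mul, ← hc]
      abel
    have hnil : IsNilpotent (Matrix.toLin' A - algebraMap k (End k (Fin 2 → k)) a) := by
      refine ⟨2, ?_⟩
      have h4 := congrArg Matrix.toLinAlgEquiv' hsq
      rw [map_pow, map_sub, map_zero, AlgEquiv.commutes] at h4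
      exact h4
    have h5 := End.eq_zero_of_isNilpotent_isSemisimple hnil
      (End.isSemisimple_sub_algebraMap_iff.2 h2)
    have h6 : A = algebraMap k (M₂ k) a := by
      apply Matrix.toLinAlgEquiv'.injective
      rw [AlgEquiv.commutes]
      exact sub_eq_zero.1 h5
    rw [h6] at hA
    simp [NonScalar, Matrix.algebraMap_matrix_apply] at hA
  · rintro ⟨a, b, hab, htr, hdet⟩
    have hp : A.charpoly = (Polynomial.X - Polynomial.C a) * (Polynomial.X - Polynomial.C b) := by
      rw [Matrix.charpoly_fin_two, htr, hdet]
      simp only [map_add, map_mul]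
      ring
    refine ⟨?_, ?_⟩
    · rw [hp]
      exact (Polynomial.Splits.X_sub_C a).mul (Polynomial.Splits.X_sub_C b)
    · refine End.isSemisimple_of_squarefree_aeval_eq_zero (p := A.charpoly) ?_ ?_
      · rw [hp, squarefree_mul_iff]
        refine ⟨(Polynomial.isCoprime_X_sub_C_of_isUnit_sub (sub_ne_zero.2 hab).isUnit).isRelPrime,
          (Polynomial.irreducible_X_sub_C a).squarefree,
          (Polynomial.irreducible_X_sub_C b).squarefree⟩
      · rw [← Matrix.charpoly_toLin']
        exact LinearMap.aeval_self_charpoly _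

variable {R k : Type*} [CommRing R] [Field k] {f : R →+* k} {p s : R} {ψ : AddChar R ℂ}
  {V : Type*} [AddCommGroup V] [Module ℂ V] {ρ : Representation ℂ (SL₂ R) V} {v v' : V}
  {τ τ' : Rˣ →* ℂˣ}

theorem Level.finrank_eq_of_hasTheta [Finite R] [FiniteDimensional ℂ V] (L : Level f p s ψ)
    (hρ : ρ.IsIrreducible) (hτ : IsPrim s τ) (h0 : v ≠ 0) (hv : HasTheta L.sq τ ρ v) :
    finrank ℂ V = (diagSubgroup p).index := by
  obtain ⟨t, ht0, ht⟩ := L.exists_param hτ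
  exact le_antisymm (finrank_le_index ρ hρ h0 _ fun g hg => ⟨_, hv ⟨g, hg⟩⟩)
    (L.index_le_finrank (by rwa [map_zero]) (hv.isEig L.sq ht) h0)

/-- Over a character with split reduction, an irreducible representation contains a primitive
character `τ`. -/
theorem Level.exists_hasTheta_of_split [Finite R] [FiniteDimensional ℂ V] (L : Level f p s ψ)
    {A : M₂ R} (h0 : v ≠ 0) (hv : IsEig (slMat R) p ψ ρ A v)
    (hs : ∃ a b, a ≠ b ∧ (A.map f).trace = a + b ∧ (A.map f).det = a * b) :
    ∃ τ, IsPrim s τ ∧ ∃ w, w ≠ 0 ∧ HasTheta L.sq τ ρ w := by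
  obtain ⟨a, b, hab, htr, hdet⟩ := hs
  obtain ⟨g, α, β, hαβ, hg⟩ := L.exists_conj_diag A hab htr hdet
  have h1 := hv.conj g
  rw [hg] at h1
  refine L.exists_hasTheta hαβ h1 fun hx => h0 ?_
  have := congrArg (ρ g⁻¹) hx
  rwa [← Module.End.mul_apply, ← map_mul, inv_mul_cancel, map_one, map_zero] at this

/-- The centralizer index is at most `(q-1)(q+1)q^(2ℓ-2)`, and `q - 1 < q`. -/
theorem Level.finrank_lt_of_nonsplit [Finite R] [FiniteDimensional ℂ V] (L : Level f p s ψ)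
    (hρ : ρ.IsIrreducible) {A : M₂ R} (h0 : v ≠ 0) (hv : IsEig (slMat R) p ψ ρ A v)
    (hA : NonScalar (A.map f))
    (hns : ¬ ∃ a b, a ≠ b ∧ (A.map f).trace = a + b ∧ (A.map f).det = a * b)
    {R' : Type*} [CommRing R'] [Finite R'] (r : R →+* R')
    (hr : Function.Surjective r) (hr0 : ∀ x, r x = 0 → p ∣ x) (f' : R' →+* k)
    (hf' : ∀ x, f' (r x) = f x) {l : ℕ} (hl : 1 ≤ l) (hR' : Nat.card R' = Nat.card k ^ l) :
    finrank ℂ V < (Nat.card k + 1) * Nat.card k ^ (2 * l - 1) := by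
  have hk : Finite k := Finite.of_surjective f L.surjective
  have h1 := L.finrank_le hρ h0 hv hA r hr hr0 f' hf'
  have hmap : (A.map r).map f' = A.map f := by ext i j; simp [hf']
  have hs' : Function.Surjective f' := fun y => by
    obtain ⟨x, rfl⟩ := L.surjective y
    exact ⟨r x, hf' x⟩
  have h2 := index_centralizer_le f' hs' (fun x hx => by
    obtain ⟨y, rfl⟩ := hr x
    exact (L.isUnit y (by rwa [hf'] at hx)).map r) (A.map r) (by rwa [hmap]) (by rwa [hmap]) hR'
  set q := Nat.card k
  have hq : 1 < q := Finite.one_lt_card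
  obtain ⟨m, rfl⟩ := Nat.exists_eq_add_of_le' hl
  rw [show 2 * (m + 1) - 1 = 2 * m + 1 by omega]
  have hpos : 0 < q ^ (2 * (m + 1)) := by positivity
  obtain ⟨c, hc⟩ := Nat.exists_eq_add_of_le' hq.le
  have e2 : q ^ 2 - 1 = c * (q + 1) := by rw [hc]; apply Nat.sub_eq_of_eq_add; ring
  rw [e2] at h2
  refine lt_of_le_of_lt h1 (lt_of_mul_lt_mul_right (a := q ^ 2) ?_ (Nat.zero_le _))
  refine lt_of_le_of_lt h2 ?_
  have : c * (q + 1) * q ^ (2 * (m + 1)) < q * (q + 1) * q ^ (2 * (m + 1)) :=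
    Nat.mul_lt_mul_of_pos_right (Nat.mul_lt_mul_of_pos_right (by omega) (by omega)) hpos
  refine lt_of_lt_of_eq this ?_
  ring

theorem card_eq_two_mul {X Q : Type*} (F : X → Q) (hF : Function.Surjective F)
    (i : X → X) (hi : ∀ x, i x ≠ x) (h : ∀ x y, F x = F y ↔ y = x ∨ y = i x) :
    Nat.card X = 2 * Nat.card Q := by
  choose g hg using hF
  have e : Bool × Q ≃ X := Equiv.ofBijective (fun y => if y.1 then g y.2 else i (g y.2)) (by
    have hFi : ∀ x, F (i x) = F x := fun x => ((h x (i x)).2 (Or.inr rfl)).symm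
    constructor
    · rintro ⟨b, y⟩ ⟨b', y'⟩ hbb
      have h1 := congrArg F hbb
      have h2 : ∀ (b : Bool) y, F (if b then g y else i (g y)) = y := by
        intro b y
        cases b <;> simp [hg, hFi]
      dsimp only at h1
      rw [h2, h2] at h1
      subst h1
      cases b <;> cases b' <;> simp at hbb ⊢
      · exact hi _ hbb
      · exact hi _ hbb.symm
    · intro x
      rcases (h (g (F x)) x).1 (hg _) with h1 | h1
      · exact ⟨(true, F x), by simp [← h1]⟩
      · exact ⟨(false, F x), by simp [← h1]⟩)
  rw [← Nat.card_congr e, Nat.card_prod]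
  simp

end Dimension

/-! ### Quotients of the discrete valuation ring -/

section Concrete

open Module

local notation "M₂" => Matrix (Fin 2) (Fin 2)
local notation "SL₂" => Matrix.SpecialLinearGroup (Fin 2)

variable {O : Type*} [CommRing O] [IsDomain O] [IsDiscreteValuationRing O] {π : O}

theorem mk_eq_zero_iff_dvd (hπ : Irreducible π) (n : ℕ) (x : O) :
    Ideal.Quotient.mk (maximalIdeal O ^ n) x = 0 ↔ π ^ n ∣ x := by
  rw [Ideal.Quotient.eq_zero_iff_mem, hπ.maximalIdeal_eq, Ideal.span_singleton_pow,
    Ideal.mem_span_singleton]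

theorem toResidue_mk {n : ℕ} (h : 1 ≤ n) (x : O) :
    toResidue O h (Ideal.Quotient.mk _ x) = residue O x := rfl

theorem toResidue_surjective {n : ℕ} (h : 1 ≤ n) : Function.Surjective (toResidue O h) := by
  intro y
  obtain ⟨x, rfl⟩ := residue_surjective y
  exact ⟨_, toResidue_mk h x⟩

theorem isUnit_of_toResidue {n : ℕ} (h : 1 ≤ n) (x : Quo O n) (hx : toResidue O h x ≠ 0) :
    IsUnit x := by
  obtain ⟨y, rfl⟩ := Ideal.Quotient.mk_surjective x
  rw [toResidue_mk, residue_ne_zero_iff_isUnit] at hx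
  exact hx.map _

theorem card_quo (hπ : Irreducible π) (n : ℕ) : Nat.card (Quo O n) = residueCard O ^ n := by
  have h := cardQuot_pow_of_prime (S := O) (P := maximalIdeal O) (i := n) (by
    rw [hπ.maximalIdeal_eq, Ne, Ideal.span_singleton_eq_bot]
    exact hπ.ne_zero)
  exact h

theorem finite_quo [Finite (ResidueField O)] (hπ : Irreducible π) (n : ℕ) : Finite (Quo O n) := by
  refine Nat.finite_of_card_ne_zero ?_
  rw [card_quo hπ]
  exact pow_ne_zero _ Nat.card_pos.ne'

theorem mk_dvd_mk (hπ : Irreducible π) {i n : ℕ} (hi : i ≤ n) (x : O) :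
    (Ideal.Quotient.mk (maximalIdeal O ^ n) π) ^ i ∣ Ideal.Quotient.mk (maximalIdeal O ^ n) x ↔
      π ^ i ∣ x := by
  constructor
  · rintro ⟨c, hc⟩
    obtain ⟨y, rfl⟩ := Ideal.Quotient.mk_surjective c
    rw [← map_pow, ← map_mul, ← sub_eq_zero, ← map_sub, mk_eq_zero_iff_dvd hπ] at hc
    have := ((pow_dvd_pow π hi).trans hc).add (dvd_mul_right (π ^ i) y)
    rwa [sub_add_cancel] at this
  · rintro ⟨y, rfl⟩
    rw [map_mul, map_pow]
    exact dvd_mul_right _ _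

theorem red_eq_zero_iff (hπ : Irreducible π) {i n : ℕ} (hi : i ≤ n) (x : Quo O n) :
    red O hi x = 0 ↔ (Ideal.Quotient.mk (maximalIdeal O ^ n) π) ^ i ∣ x := by
  obtain ⟨y, rfl⟩ := Ideal.Quotient.mk_surjective x
  rw [mk_dvd_mk hπ hi, ← mk_eq_zero_iff_dvd hπ]
  rfl

theorem red_surjective {i n : ℕ} (hi : i ≤ n) : Function.Surjective (red O hi) :=
  Ideal.Quotient.factor_surjective _

theorem toResidue_red {i n : ℕ} (h : 1 ≤ i) (hi : i ≤ n) (x : Quo O n) :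
    toResidue O h (red O hi x) = toResidue O (h.trans hi) x := by
  obtain ⟨y, rfl⟩ := Ideal.Quotient.mk_surjective x
  rfl

theorem level (hπ : Irreducible π) {e : ℕ} (he : Ideal.span {(2 : O)} = maximalIdeal O ^ e)
    {l : ℕ} (hl : e < l) (ψ : AddChar (Quo O (2 * l)) ℂ)
    (hψ : ψ (Ideal.Quotient.mk (maximalIdeal O ^ (2 * l)) (π ^ (2 * l - 1))) ≠ 1) :
    Level (toResidue O (by omega : 1 ≤ 2 * l))
      ((Ideal.Quotient.mk (maximalIdeal O ^ (2 * l)) π) ^ l)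
      ((Ideal.Quotient.mk (maximalIdeal O ^ (2 * l)) π) ^ (2 * l - 1)) ψ where
  surjective := toResidue_surjective _
  isUnit := isUnit_of_toResidue _
  sq := by rw [← pow_add, ← two_mul, ← map_pow, mk_eq_zero_iff_dvd hπ]
  dvd_of_mul y h := by
    obtain ⟨y, rfl⟩ := Ideal.Quotient.mk_surjective y
    rw [← map_pow, ← map_mul, mk_eq_zero_iff_dvd hπ, two_mul, pow_add] at h
    rw [mk_dvd_mk hπ (by omega)]
    exact (mul_dvd_mul_iff_left (pow_ne_zero _ hπ.ne_zero)).1 h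
  dvd := pow_dvd_pow _ (by omega)
  socle x hx := by
    obtain ⟨y, rfl⟩ := Ideal.Quotient.mk_surjective x
    rw [toResidue_mk, residue_eq_zero_iff, hπ.maximalIdeal_eq, Ideal.mem_span_singleton] at hx
    rw [← map_pow, ← map_mul, mk_eq_zero_iff_dvd hπ]
    have h2 : π ^ (2 * l) = π ^ (2 * l - 1) * π := by rw [← pow_succ]; congr 1; omega
    rw [h2]
    exact mul_dvd_mul_left _ hx
  dvd_socle t ht := by
    obtain ⟨y, rfl⟩ := Ideal.Quotient.mk_surjective t
    rw [Ne, mk_eq_zero_iff_dvd hπ] at ht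
    have hy : y ≠ 0 := fun h => ht (h ▸ dvd_zero _)
    obtain ⟨j, hj⟩ := IsDiscreteValuationRing.associated_pow_irreducible hy hπ
    have hjl : j ≤ 2 * l - 1 := by
      by_contra hlt
      exact ht ((pow_dvd_pow π (by omega)).trans hj.symm.dvd)
    rw [← map_pow]
    exact map_dvd _ (hj.dvd.trans (pow_dvd_pow π hjl))
  psi_ne := by rwa [← map_pow]
  -- If `π^ℓ` divided `2`, it would divide `π^e`, against `e < ℓ`.
  two h := by
    have h2 : (2 : Quo O (2 * l)) = Ideal.Quotient.mk _ (2 : O) := rfl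
    rw [h2, mk_dvd_mk hπ (by omega)] at h
    have h3 : π ^ e ∈ Ideal.span {(2 : O)} := by
      rw [he, hπ.maximalIdeal_eq, Ideal.span_singleton_pow]
      exact Ideal.mem_span_singleton_self _
    have := (pow_dvd_pow_iff hπ.ne_zero hπ.not_isUnit).1 (h.trans (Ideal.mem_span_singleton.1 h3))
    omega

theorem mem_congruenceSubgroup_iff (hπ : Irreducible π) {i n : ℕ} (hi : i ≤ n) (γ : SL O n) :
    γ ∈ congruenceSubgroup O hi ↔
      ∃ B, slMat (Quo O n) γ = 1 + (Ideal.Quotient.mk (maximalIdeal O ^ n) π) ^ i • B := by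
  have h1 : γ ∈ congruenceSubgroup O hi ↔ ∀ a b, red O hi ((γ.1 - 1) a b) = 0 := by
    rw [congruenceSubgroup, MonoidHom.mem_ker, Matrix.SpecialLinearGroup.ext_iff]
    refine forall_congr' fun a => forall_congr' fun b => ?_
    rw [Matrix.sub_apply, map_sub, sub_eq_zero]
    have : red O hi ((1 : M₂ (Quo O n)) a b) = (1 : M₂ (Quo O i)) a b := by
      rw [Matrix.one_apply, Matrix.one_apply]
      split_ifs <;> simp
    rw [this]
    rfl
  rw [h1]
  simp only [red_eq_zero_iff hπ, Dvd.dvd]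
  constructor
  · intro h
    choose B hB using h
    refine ⟨Matrix.of B, ?_⟩
    rw [slMat_apply, ← sub_eq_iff_eq_add']
    ext a b
    exact hB a b
  · rintro ⟨B, hB⟩ a b
    refine ⟨B a b, ?_⟩
    rw [slMat_apply] at hB
    rw [hB, add_sub_cancel_left]
    rfl

theorem isEig_of_psiClass (hπ : Irreducible π) {l : ℕ} {ψ : AddChar (Quo O (2 * l)) ℂ}
    {A : M₂ (Quo O l)} {V : Type*} [AddCommGroup V] [Module ℂ V]
    {ρ : Representation ℂ (SL O (2 * l)) V} {v : V}
    (hv : ∀ k : congruenceSubgroup O (by omega : l ≤ 2 * l), ρ k v = psiClass ψ A k • v) :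
    IsEig (slMat (Quo O (2 * l))) ((Ideal.Quotient.mk (maximalIdeal O ^ (2 * l)) π) ^ l) ψ ρ
      (lift A) v := by
  intro γ B _ h2
  have hγ := (mem_congruenceSubgroup_iff hπ (by omega : l ≤ 2 * l) γ).2 ⟨B, h2⟩
  rw [hv ⟨γ, hγ⟩, psiClass_eq ψ π A (lift A) B (lift_map A) ⟨γ, hγ⟩ h2]

/-- If the reduction of `A` were scalar, the reductions of `v` and `Av` would span at most a line.
-/
theorem nonScalar_of_isCyclicMatrix {R k : Type*} [CommRing R] [Field k] (f : R →+* k)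
    {A : M₂ R} (hA : IsCyclicMatrix A) : NonScalar (A.map f) := by
  by_contra h
  simp only [NonScalar, not_or, not_not, Matrix.map_apply] at h
  obtain ⟨h01, h10, h11⟩ := h
  obtain ⟨v, hv⟩ := hA
  have key : ∀ x : Fin 2 → R, ∃ c : k, ∀ i, f (x i) = c * f (v i) := by
    intro x
    have hx : x ∈ Submodule.span R (Set.range fun j : Fin 2 => (A ^ (j : ℕ)) *ᵥ v) :=
      hv ▸ Submodule.mem_top
    obtain ⟨c, rfl⟩ := (Submodule.mem_span_range_iff_exists_fun R).1 hx
    refine ⟨f (c 0) + f (c 1) * f (A 0 0), fun i => ?_⟩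
    rw [Fin.sum_univ_two]
    have hw : f ((A *ᵥ v) i) = f (A 0 0) * f (v i) := by
      fin_cases i <;> simp [Matrix.mulVec, dotProduct, Fin.sum_univ_two, h01, h10, h11]
    simp only [Fin.val_zero, Fin.val_one, pow_zero, pow_one, Matrix.one_mulVec, Pi.add_apply,
      Pi.smul_apply, smul_eq_mul, map_add, map_mul, hw]
    ring
  obtain ⟨c, hc⟩ := key ![1, 0]
  obtain ⟨d, hd⟩ := key ![0, 1]
  have h1 := hc 0
  have h2 := hc 1
  have h3 := hd 1
  simp at h1 h2 h3
  rcases h2 with h2 | h2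
  · rw [h2, zero_mul] at h1; exact one_ne_zero h1
  · rw [h2, mul_zero] at h3; exact one_ne_zero h3

end Concrete

/-! ### Dimensions and the count for the concrete groups -/

section Main

open Module

local notation "M₂" => Matrix (Fin 2) (Fin 2)

variable {O : Type*} [CommRing O] [IsDomain O] [IsDiscreteValuationRing O]
  [Finite (ResidueField O)] {π : O} {l : ℕ} {ψ : AddChar (Quo O (2 * l)) ℂ} {hl : 1 ≤ 2 * l}

theorem card_dvd (hπ : Irreducible π) :
    Nat.card {x : Quo O (2 * l) // (Ideal.Quotient.mk (maximalIdeal O ^ (2 * l)) π) ^ l ∣ x} =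
      residueCard O ^ l := by
  have := finite_quo hπ (2 * l)
  have h := card_preimage_mul (red O (by omega : l ≤ 2 * l)).toAddMonoidHom (red_surjective (by omega : l ≤ 2 * l)) {0}
  rw [card_quo hπ, card_quo hπ, Nat.card_unique (α := ({0} : Set (Quo O l))), one_mul,
    (by ring : residueCard O ^ (2 * l) = residueCard O ^ l * residueCard O ^ l)] at h
  refine Eq.trans ?_ (Nat.eq_of_mul_eq_mul_right (pow_pos Nat.card_pos _ : 0 < residueCard O ^ l) h)
  exact Nat.card_congr (Equiv.subtypeEquivRight fun x =>
    (red_eq_zero_iff hπ (by omega : l ≤ 2 * l) x).symm)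

theorem index_diagSubgroup_quo (hπ : Irreducible π) (h1 : 1 ≤ l)
    (L : Level (toResidue O hl) ((Ideal.Quotient.mk (maximalIdeal O ^ (2 * l)) π) ^ l)
      ((Ideal.Quotient.mk (maximalIdeal O ^ (2 * l)) π) ^ (2 * l - 1)) ψ) :
    (diagSubgroup ((Ideal.Quotient.mk (maximalIdeal O ^ (2 * l)) π) ^ l)).index =
      (residueCard O + 1) * residueCard O ^ (2 * l - 1) := by
  have := finite_quo hπ (2 * l)
  exact index_diagSubgroup _ L.surjective L.isUnit L.sq h1 (card_quo hπ _) (card_dvd hπ)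

section

variable {V : Type*} [AddCommGroup V] [Module ℂ V] {ρ : Representation ℂ (SL O (2 * l)) V} {v : V}
  {A : M₂ (Quo O (2 * l))}

theorem finrank_le_and_iff [FiniteDimensional ℂ V] (hπ : Irreducible π) (h1 : 1 ≤ l)
    (L : Level (toResidue O hl) ((Ideal.Quotient.mk (maximalIdeal O ^ (2 * l)) π) ^ l)
      ((Ideal.Quotient.mk (maximalIdeal O ^ (2 * l)) π) ^ (2 * l - 1)) ψ)
    (hρ : ρ.IsIrreducible) (h0 : v ≠ 0)
    (hv : IsEig (slMat _) ((Ideal.Quotient.mk (maximalIdeal O ^ (2 * l)) π) ^ l) ψ ρ A v)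
    (hA : NonScalar (A.map (toResidue O hl))) :
    finrank ℂ V ≤ (residueCard O + 1) * residueCard O ^ (2 * l - 1) ∧
      (finrank ℂ V = (residueCard O + 1) * residueCard O ^ (2 * l - 1) ↔
        ∃ a b, a ≠ b ∧ (A.map (toResidue O hl)).trace = a + b ∧
          (A.map (toResidue O hl)).det = a * b) := by
  have := finite_quo hπ (2 * l)
  have := finite_quo hπ l
  by_cases hs : ∃ a b, a ≠ b ∧ (A.map (toResidue O hl)).trace = a + b ∧
      (A.map (toResidue O hl)).det = a * b
  · obtain ⟨τ, hτ, w, hw0, hw⟩ := L.exists_hasTheta_of_split h0 hv hs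
    have h := L.finrank_eq_of_hasTheta hρ hτ hw0 hw
    rw [index_diagSubgroup_quo hπ h1 L] at h
    exact ⟨h.le, fun _ => hs, fun _ => h⟩
  · have h := L.finrank_lt_of_nonsplit hρ h0 hv hA hs (red O (by omega : l ≤ 2 * l))
      (red_surjective _) (fun x hx => (red_eq_zero_iff hπ _ x).1 hx) (toResidue O h1)
      (toResidue_red h1 _) h1 (card_quo hπ l)
    exact ⟨h.le, fun h' => absurd h' h.ne, fun h' => absurd h' hs⟩

theorem exists_isEig_of_isPrimitive [FiniteDimensional ℂ V] (hπ : Irreducible π)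
    (L : Level (toResidue O hl) ((Ideal.Quotient.mk (maximalIdeal O ^ (2 * l)) π) ^ l)
      ((Ideal.Quotient.mk (maximalIdeal O ^ (2 * l)) π) ^ (2 * l - 1)) ψ)
    (hρ : ρ.IsIrreducible) (hp : IsPrimitive ρ) :
    ∃ A v, v ≠ 0 ∧
      IsEig (slMat _) ((Ideal.Quotient.mk (maximalIdeal O ^ (2 * l)) π) ^ l) ψ ρ A v ∧
      NonScalar (A.map (toResidue O hl)) := by
  have := finite_quo hπ (2 * l)
  have := nontrivial_of_isIrreducible ρ hρ
  obtain ⟨A, v, h0, hv⟩ := L.exists_isEig (ρ := ρ)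
  obtain ⟨γ, hγ, h1⟩ : ∃ γ ∈ congruenceSubgroup O (Nat.sub_le (2 * l) 1), ρ γ ≠ 1 := by
    have := hp.1
    push Not at this
    exact this
  obtain ⟨B, hB⟩ := (mem_congruenceSubgroup_iff hπ _ γ).1 hγ
  exact ⟨A, v, h0, hv, L.nonScalar hρ h0 hv hB h1⟩

theorem isPrimitive_of_hasTheta (hπ : Irreducible π)
    (L : Level (toResidue O hl) ((Ideal.Quotient.mk (maximalIdeal O ^ (2 * l)) π) ^ l)
      ((Ideal.Quotient.mk (maximalIdeal O ^ (2 * l)) π) ^ (2 * l - 1)) ψ)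
    {τ : (Quo O (2 * l))ˣ →* ℂˣ}
    (hτ : IsPrim ((Ideal.Quotient.mk (maximalIdeal O ^ (2 * l)) π) ^ (2 * l - 1)) τ)
    (h0 : v ≠ 0) (hv : HasTheta L.sq τ ρ v) : IsPrimitive ρ := by
  have := finite_quo hπ (2 * l)
  refine ⟨fun h => ?_, fun χ h => ?_⟩
  · refine L.not_scalar_of_hasTheta hτ h0 hv (fun _ => 1) fun γ B hB => ?_
    rw [one_smul]
    exact h γ ((mem_congruenceSubgroup_iff hπ _ γ).2 ⟨B, hB⟩)
  · refine L.not_scalar_of_hasTheta hτ h0 hv χ fun γ B hB => ?_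
    exact h γ ((mem_congruenceSubgroup_iff hπ _ γ).2 ⟨B, hB⟩)

end

/-- Sending `τ` to the representation containing its character is onto the isomorphism classes, with
fibres `{τ, τ⁻¹}` of exactly two elements. -/
theorem two_mul_numPrimitive (hπ : Irreducible π) (h1 : 1 ≤ l)
    (L : Level (toResidue O hl) ((Ideal.Quotient.mk (maximalIdeal O ^ (2 * l)) π) ^ l)
      ((Ideal.Quotient.mk (maximalIdeal O ^ (2 * l)) π) ^ (2 * l - 1)) ψ) :
    (residueCard O - 1) ^ 2 * residueCard O ^ (2 * l - 2) =
      2 * numPrimitive O (2 * l) ((residueCard O + 1) * residueCard O ^ (2 * l - 1)) := by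
  have := finite_quo hπ (2 * l)
  have hcard := L.card_isPrim h1 (card_quo hπ _)
  have hD := index_diagSubgroup_quo hπ h1 L
  set D := (residueCard O + 1) * residueCard O ^ (2 * l - 1) with hDdef
  set s := (Ideal.Quotient.mk (maximalIdeal O ^ (2 * l)) π) ^ (2 * l - 1) with hs
  have hex : ∀ τ : {τ : (Quo O (2 * l))ˣ →* ℂˣ // IsPrim s τ},
      ∃ ρ : {ρ : Representation ℂ (SL O (2 * l)) (Fin D → ℂ) // ρ.IsIrreducible ∧ IsPrimitive ρ},
        ∃ v, v ≠ 0 ∧ HasTheta L.sq τ.1 ρ.1 v := by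
    rintro ⟨τ, hτ⟩
    obtain ⟨d, σ, hσ, v, h0, hv⟩ := exists_irreducible_of_character
      (diagSubgroup ((Ideal.Quotient.mk (maximalIdeal O ^ (2 * l)) π) ^ l)) (theta L.sq τ)
    have hd := L.finrank_eq_of_hasTheta hσ hτ h0 hv
    rw [finrank_fin_fun, hD] at hd
    subst hd
    exact ⟨⟨σ, hσ, isPrimitive_of_hasTheta hπ L hτ h0 hv⟩, v, h0, hv⟩
  choose F v hv0 hv using hex
  have hiso : ∀ {ρ σ : Representation ℂ (SL O (2 * l)) (Fin D → ℂ)} {τ} {v w : Fin D → ℂ},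
      ρ.IsIrreducible → σ.IsIrreducible → v ≠ 0 → w ≠ 0 → HasTheta L.sq τ ρ v →
      HasTheta L.sq τ σ w → Nonempty (ρ.Equiv σ) := by
    intro ρ σ τ v w hρ hσ h0 h0' h h'
    refine equiv_of_eigenvector ρ σ hρ hσ _ h0 h0' (fun g hg => ⟨_, h ⟨g, hg⟩, h' ⟨g, hg⟩⟩) ?_ ?_
    · rw [finrank_fin_fun, hD]
    · rw [finrank_fin_fun, hD]
  have hinv : ∀ τ : {τ : (Quo O (2 * l))ˣ →* ℂˣ // IsPrim s τ}, IsPrim s τ.1⁻¹ := by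
    rintro ⟨τ, u, hu, h⟩
    exact ⟨u, hu, inv_ne_one.2 h⟩
  refine hcard.symm.trans ?_
  refine card_eq_two_mul (fun τ => (Quotient.mk (primitiveSetoid O (2 * l) D) (F τ))) ?_
    (fun τ => ⟨τ.1⁻¹, hinv τ⟩) ?_ ?_
  · intro x
    induction x using Quotient.inductionOn with | h ρ =>
    obtain ⟨ρ, hρ, hp⟩ := ρ
    obtain ⟨A, w, h0, hw, hA⟩ := exists_isEig_of_isPrimitive hπ L hρ hp
    -- Having the maximal dimension forces the split case, which supplies `τ`; the shared
    -- eigencharacter and equal dimensions then give the isomorphism.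
    have hsplit := (finrank_le_and_iff hπ h1 L hρ h0 hw hA).2.1 (finrank_fin_fun ℂ)
    obtain ⟨τ, hτ, w', hw0', hw'⟩ := L.exists_hasTheta_of_split h0 hw hsplit
    exact ⟨⟨τ, hτ⟩, Quotient.sound (hiso (F ⟨τ, hτ⟩).2.1 hρ (hv0 _) hw0' (hv ⟨τ, hτ⟩) hw')⟩
  · intro τ h
    exact L.ne_inv τ.2 (congrArg Subtype.val h).symm
  · intro τ τ'
    constructor
    · intro h
      obtain ⟨e⟩ := Quotient.exact h
      have he : HasTheta L.sq τ.1 (F τ').1 (e.toLinearEquiv (v τ)) := by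
        intro g
        have := e.toIntertwiningMap.isIntertwining _ _ g (v τ)
        rw [hv τ g, map_smul] at this
        exact this.symm
      have he0 : e.toLinearEquiv (v τ) ≠ 0 := by simpa using hv0 τ
      rcases L.eq_or_eq_inv (F τ').2.1 τ.2 τ'.2 he0 (hv0 τ') he (hv τ') with h | h
      · exact Or.inl (Subtype.ext h)
      · exact Or.inr (Subtype.ext h)
    · rintro (rfl | rfl)
      · rfl
      -- The Weyl translate of the `τ`-eigenvector is a `τ⁻¹`-eigenvector in the same
      -- representation.
      · refine Quotient.sound (hiso (F τ).2.1 (F _).2.1 ?_ (hv0 _) ((hv τ).weyl L.sq) (hv _))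
        intro hx
        have := congrArg ((F τ).1 (weyl _)⁻¹) hx
        rw [← Module.End.mul_apply, ← map_mul, inv_mul_cancel, map_one, map_zero] at this
        exact hv0 τ this

end Main

end SLTwo

end


theorem mainTheorem10 {O : Type*} [CommRing O] [IsDomain O] [IsDiscreteValuationRing O]
    [IsAdicComplete (IsLocalRing.maximalIdeal O) O] [Finite (IsLocalRing.ResidueField O)]
    [CharP (IsLocalRing.ResidueField O) 2] [CharZero O]
    (π : O) (hπ : Irreducible π)
    (e : ℕ) (he : Ideal.span {(2 : O)} = IsLocalRing.maximalIdeal O ^ e)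
    (l : ℕ) (hl : e < l)
    (ψ : AddChar (SLTwo.Quo O (2 * l)) ℂ)
    (hψ : ψ (Ideal.Quotient.mk (IsLocalRing.maximalIdeal O ^ (2 * l)) (π ^ (2 * l - 1))) ≠ 1) :
    (∀ {V : Type*} [AddCommGroup V] [Module ℂ V] [FiniteDimensional ℂ V]
        (ρ : Representation ℂ (SLTwo.SL O (2 * l)) V),
        ρ.IsIrreducible → SLTwo.IsPrimitive ρ →
          Module.finrank ℂ V ≤ (SLTwo.residueCard O + 1) * SLTwo.residueCard O ^ (2 * l - 1)) ∧
    (∀ A : Matrix (Fin 2) (Fin 2) (SLTwo.Quo O l), SLTwo.IsCyclicMatrix A →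
      ∀ {V : Type*} [AddCommGroup V] [Module ℂ V] [FiniteDimensional ℂ V]
        (ρ : Representation ℂ (SLTwo.SL O (2 * l)) V),
        SLTwo.IsIrrAbove ρ (SLTwo.psiClass ψ A) →
          (Module.finrank ℂ V = (SLTwo.residueCard O + 1) * SLTwo.residueCard O ^ (2 * l - 1) ↔
            SLTwo.IsSplitSemisimple
              (A.map (SLTwo.toResidue O (Nat.one_le_of_lt hl))))) ∧
    (SLTwo.numPrimitive O (2 * l)
        ((SLTwo.residueCard O + 1) * SLTwo.residueCard O ^ (2 * l - 1)) : ℚ) =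
      ((SLTwo.residueCard O : ℚ) - 1) ^ 2 * (SLTwo.residueCard O : ℚ) ^ (2 * l - 2) / 2 := by
  have h1 : 1 ≤ l := Nat.one_le_of_lt hl
  have L := SLTwo.level hπ he hl ψ hψ
  refine ⟨?_, ?_, ?_⟩
  · intro V _ _ _ ρ hρ hp
    obtain ⟨A, v, h0, hv, hA⟩ := SLTwo.exists_isEig_of_isPrimitive hπ L hρ hp
    exact (SLTwo.finrank_le_and_iff hπ h1 L hρ h0 hv hA).1
  · intro A hA V _ _ _ ρ hρ
    have := SLTwo.finite_quo (O := O) hπ (2 * l)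
    obtain ⟨v, h0, hv⟩ := hρ.exists_eigenvector
    have hA' := SLTwo.nonScalar_of_isCyclicMatrix (SLTwo.toResidue O h1) hA
    have hmap : (SLTwo.lift A).map (SLTwo.toResidue O (by omega : 1 ≤ 2 * l)) =
        A.map (SLTwo.toResidue O h1) := by
      conv_rhs => rw [← SLTwo.lift_map A]
      ext i j
      exact (SLTwo.toResidue_red h1 (by omega : l ≤ 2 * l) (SLTwo.lift A i j)).symm
    rw [← hmap] at hA'
    have h := (SLTwo.finrank_le_and_iff hπ h1 L hρ.1 h0 (SLTwo.isEig_of_psiClass hπ hv) hA').2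
    rw [h, ← SLTwo.isSplitSemisimple_iff hA', hmap]
  · have h := congrArg (Nat.cast (R := ℚ)) (SLTwo.two_mul_numPrimitive hπ h1 L)
    have hq : 1 ≤ SLTwo.residueCard O := Nat.card_pos
    push_cast [Nat.cast_sub hq] at h
    rw [h]
    ring
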